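/- Let $m>0$ and let $L_0f=-i\,\frac pm\,\partial_q f$ (distributional derivative) be the self-adjoint operator in $L^2(\mathbb R^2)$, with variables $(q,p)$, on its maximal domain $\mathrm{dom}(L_0)=\{f\in L^2(\mathbb R^2):\ p\,\partial_q f\in L^2(\mathbb R^2)\}$, and let $R^0_z=(L_0-z)^{-1}$ for $z\in\mathbb C\setminus\mathbb R$. Let $\gamma:\mathrm{dom}(L_0)\to L^2(\mathbb R,|p|\,dp)$, $(\gamma f)(p)=f(0,p)$, be the trace map, where $f$ is represented by a function that is continuous in $q$ for almost every $p$; $\gamma$ is well defined, linear, and bounded for the graph norm of $L_0$. For $z\in\mathbb C\setminus\mathbb R$ let $$G_z:L^2(\mathbb R,|p|^{-1}dp)\to L^2(\mathbb R^2),\qquad (G_z\phi)(q,p)=g_z(q,p)\,\phi(p),\qquad g_z(q,p)=\theta(qp\,\mathrm{Im}\,z)\,\mathrm{sgn}(\mathrm{Im}\,z)\,\frac{im}{|p|}\,e^{imzq/p},$$ where $\theta$ is the Heaviside function. Then $G_z$ is bounded and $G_z=(\gamma R^0_{\bar z})^*$; here and below, adjoints are taken with respect to the duality of $L^2(\mathbb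 R,|p|^{-1}dp)$ and $L^2(\mathbb R,|p|\,dp)$ given by the scalar product of $L^2(\mathbb R,dp)$. Let $b\in(\mathbb R\setminus\{0\})\cup\{\infty\}$, put $B(p)=bp^2$ if $b\in\mathbb R\setminus\{0\}$ and $B(p)=\infty$ if $b=\infty$ (with $1/\infty=0$), and let $$\Lambda^B_z:L^2(\mathbb R,|p|\,dp)\to L^2(\mathbb R,|p|^{-1}dp),\qquad (\Lambda^B_z\phi)(p)=\frac{\phi(p)}{\frac1{B(p)}-\mathrm{sgn}(\mathrm{Im}\,z)\frac{im}{2|p|}},$$ a bounded operator. Let $(\Pi'f)(p)=\frac12(f(p)-f(-p))$ be the projector on odd functions in $L^2(\mathbb R,|p|\,dp)$ and in $L^2(\mathbb R,|p|^{-1}dp)$. Then $L_0\!\upharpoonright\!\ker\gamma$ is densely defined, closed and symmetric, and it has a self-adjoint extension $L_B$ such that for every $z\in\mathbb C\setminus\mathbb R$ the bounded operator $$R^B_z=R^0_z+G_z\,\Pi'\,\Lambda^B_z\,\Pi'\,G_{\bar z}^*$$ is the resolvent $(L_B-z)^{-1}$. Moreover, for every $z\in\mathbb C\setminus\mathbb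 R$, $$\mathrm{dom}(L_B)=\{f\in L^2(\mathbb R^2):\ f=f_z+G_z\Lambda^B_z\Pi'\gamma f_z,\ f_z\in\mathrm{dom}(L_0)\},$$ and $(L_B-z)f=(L_0-z)f_z$ whenever $f=f_z+G_z\Lambda^B_z\Pi'\gamma f_z$ with $f_z\in\mathrm{dom}(L_0)$. -/

import Mathlib

noncomputable section

namespace DeltaPrime

open MeasureTheory Complex
open scoped ENNReal NNReal ContDiff ComplexConjugate

section WeightedComposition

variable {α β : Type*} [MeasurableSpace α] [MeasurableSpace β]
  {μ : Measure α} {ν : Measure β} {r : β → α} {k : β → ℂ} {C : ℝ≥0}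

/-- The bound under which `f ↦ k · (f ∘ r)` is bounded from `L²(μ)` to `L²(ν)`. -/
def WeightBound (μ : Measure α) (ν : Measure β) (r : β → α) (k : β → ℂ) (C : ℝ≥0) : Prop :=
  (ν.withDensity fun y => ‖k y‖ₑ ^ 2).map r ≤ (C : ℝ≥0∞) • μ

theorem WeightBound.ae_eq (h : WeightBound μ ν r k C) (hr : Measurable r) (hk : Measurable k)
    {f g : α → ℂ} (hfg : f =ᵐ[μ] g) :
    (fun y => k y * f (r y)) =ᵐ[ν] fun y => k y * g (r y) := by
  have h1 : f =ᵐ[(ν.withDensity fun y => ‖k y‖ₑ ^ 2).map r] g :=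
    (Measure.absolutelyContinuous_of_le_smul h).ae_eq hfg
  have h2 := ae_of_ae_map hr.aemeasurable h1
  rw [ae_withDensity_iff (by fun_prop)] at h2
  filter_upwards [h2] with y hy
  by_cases h0 : k y = 0
  · simp [h0]
  · rw [hy (by simpa using h0)]

theorem WeightBound.eLpNorm_le (h : WeightBound μ ν r k C) (hr : Measurable r)
    (hk : Measurable k) {f : α → ℂ} (hf : Measurable f) :
    eLpNorm (fun y => k y * f (r y)) 2 ν ≤ (NNReal.sqrt C : ℝ≥0∞) * eLpNorm f 2 μ := by
  have key : ∫⁻ y, ‖k y * f (r y)‖ₑ ^ 2 ∂ν ≤ (C : ℝ≥0∞) * ∫⁻ x, ‖f x‖ₑ ^ 2 ∂μ := by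
    calc ∫⁻ y, ‖k y * f (r y)‖ₑ ^ 2 ∂ν
        = ∫⁻ y, ‖f (r y)‖ₑ ^ 2 ∂(ν.withDensity fun y => ‖k y‖ₑ ^ 2) := by
          rw [lintegral_withDensity_eq_lintegral_mul _ (by fun_prop) (by fun_prop)]
          simp [enorm_mul, mul_pow]
      _ = ∫⁻ x, ‖f x‖ₑ ^ 2 ∂((ν.withDensity fun y => ‖k y‖ₑ ^ 2).map r) := by
          rw [lintegral_map (by fun_prop) hr]
      _ ≤ ∫⁻ x, ‖f x‖ₑ ^ 2 ∂((C : ℝ≥0∞) • μ) := lintegral_mono' h le_rfl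
      _ = _ := by rw [lintegral_smul_measure, smul_eq_mul]
  have e2 : (2 : ℝ≥0∞).toReal = ((2 : ℕ) : ℝ) := by norm_num
  rw [eLpNorm_eq_lintegral_rpow_enorm_toReal (by norm_num) (by norm_num),
    eLpNorm_eq_lintegral_rpow_enorm_toReal (by norm_num) (by norm_num), e2]
  simp only [ENNReal.rpow_natCast]
  refine (ENNReal.rpow_le_rpow key (by norm_num)).trans ?_
  rw [ENNReal.mul_rpow_of_nonneg _ _ (by norm_num)]
  gcongr
  rw [NNReal.sqrt_eq_rpow, ← ENNReal.coe_rpow_of_nonneg _ (by norm_num)]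
  norm_num

theorem WeightBound.memLp (h : WeightBound μ ν r k C) (hr : Measurable r)
    (hk : Measurable k) (f : Lp ℂ 2 μ) : MemLp (fun y => k y * f (r y)) 2 ν :=
  ⟨(hk.mul ((Lp.stronglyMeasurable f).measurable.comp hr)).aestronglyMeasurable,
    (h.eLpNorm_le hr hk (Lp.stronglyMeasurable f).measurable).trans_lt
      (ENNReal.mul_lt_top ENNReal.coe_lt_top (Lp.eLpNorm_lt_top f))⟩

/-- The bounded operator `L²(μ) → L²(ν)`, `f ↦ k · (f ∘ r)`. -/
def weightedComp (h : WeightBound μ ν r k C) (hr : Measurable r) (hk : Measurable k) :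
    Lp ℂ 2 μ →L[ℂ] Lp ℂ 2 ν :=
  LinearMap.mkContinuous
    { toFun := fun f => (h.memLp hr hk f).toLp (fun y => k y * f (r y))
      map_add' := fun f g => by
        rw [← MemLp.toLp_add, MemLp.toLp_eq_toLp_iff]
        filter_upwards [h.ae_eq hr hk (Lp.coeFn_add f g)] with y hy
        rw [hy]
        simp [mul_add]
      map_smul' := fun c f => by
        rw [RingHom.id_apply, ← MemLp.toLp_const_smul, MemLp.toLp_eq_toLp_iff]
        filter_upwards [h.ae_eq hr hk (Lp.coeFn_smul c f)] with y hy
        rw [hy]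
        simp [mul_left_comm] }
    (NNReal.sqrt C)
    (fun f => by
      rw [LinearMap.coe_mk, AddHom.coe_mk, Lp.norm_toLp, Lp.norm_def, ← ENNReal.coe_toReal,
        ← ENNReal.toReal_mul]
      exact ENNReal.toReal_mono
        (ENNReal.mul_lt_top ENNReal.coe_lt_top (Lp.eLpNorm_lt_top f)).ne
        (h.eLpNorm_le hr hk (Lp.stronglyMeasurable f).measurable))

theorem weightedComp_coeFn (h : WeightBound μ ν r k C) (hr : Measurable r) (hk : Measurable k)
    (f : Lp ℂ 2 μ) : weightedComp h hr hk f =ᵐ[ν] fun y => k y * f (r y) :=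
  MemLp.coeFn_toLp (h.memLp hr hk f)

end WeightedComposition

/-- The measure `|p|ⁿ dp` on the line; only `n = 1` and `n = -1` are used. -/
def absMeasure (n : ℤ) : Measure ℝ :=
  volume.withDensity fun p => ENNReal.ofReal (|p| ^ n)

theorem measurePreserving_neg_absMeasure (n : ℤ) :
    MeasurePreserving (fun p : ℝ => -p) (absMeasure n) (absMeasure n) := by
  refine ⟨measurable_neg, ?_⟩
  ext s hs
  rw [Measure.map_apply measurable_neg hs, absMeasure, withDensity_apply _ hs,
    withDensity_apply _ (measurable_neg hs)]
  have := (Measure.measurePreserving_neg (volume : Measure ℝ)).setLIntegral_comp_preimage hs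
    (f := fun p => ENNReal.ofReal (|p| ^ n)) (by fun_prop)
  simpa using this

/-- `L²(ℝ²)`, with points `(q, p)`. -/
abbrev PhaseL2 : Type := Lp ℂ 2 (volume : Measure (ℝ × ℝ))

/-- `L²(ℝ, |p|ⁿ dp)`. -/
abbrev LineL2 (n : ℤ) : Type := Lp ℂ 2 (absMeasure n)

/-- The projector `(Π' f)(p) = (f(p) - f(-p)) / 2` on odd functions. -/
def oddProj (n : ℤ) : LineL2 n →L[ℂ] LineL2 n :=
  (1 / 2 : ℂ) • (ContinuousLinearMap.id ℂ (LineL2 n) -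
    (Lp.compMeasurePreservingₗᵢ ℂ (fun p : ℝ => -p)
      (measurePreserving_neg_absMeasure n)).toContinuousLinearMap)

/-- `g_z(q,p) = θ(q p Im z) sgn(Im z) (i m / |p|) exp(i m z q / p)`, as a function of `(q, p)`. -/
def green (m : ℝ) (z : ℂ) (x : ℝ × ℝ) : ℂ :=
  (if 0 < x.1 * x.2 * z.im then 1 else 0) * (SignType.sign z.im : ℂ) * (I * m / (|x.2| : ℝ)) *
    exp (I * m * z * x.1 / x.2)

theorem measurable_green (m : ℝ) (z : ℂ) : Measurable (green m z) := by
  unfold green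
  refine Measurable.mul (Measurable.mul (Measurable.mul ?_ measurable_const) ?_) ?_
  · exact Measurable.ite (measurableSet_lt measurable_const (by fun_prop))
      measurable_const measurable_const
  · fun_prop
  · fun_prop


theorem lintegral_exp_neg_mul_abs {c : ℝ} (hc : 0 < c) :
    ∫⁻ q : ℝ, ENNReal.ofReal (Real.exp (-c * |q|)) = ENNReal.ofReal (2 / c) := by
  have h1 : ∫ q : ℝ, Real.exp (-c * |q|) = 2 / c := by
    rw [integral_comp_abs (f := fun x => Real.exp (-c * x)),
      integral_exp_mul_Ioi (by linarith) 0]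
    simp
    field_simp
  rw [← ofReal_integral_eq_lintegral_ofReal _ (Filter.Eventually.of_forall fun q => by positivity),
    h1]
  exact Integrable.of_integral_ne_zero (by rw [h1]; positivity)

theorem enorm_green_le {m : ℝ} (hm : 0 < m) {z : ℂ} (q p : ℝ) (hp : p ≠ 0) :
    ‖green m z (q, p)‖ₑ ^ 2 ≤ ENNReal.ofReal (m ^ 2 / p ^ 2) *
      ENNReal.ofReal (Real.exp (-(2 * m * |z.im| / |p|) * |q|)) := by
  rw [← ofReal_norm, ← ENNReal.ofReal_pow (norm_nonneg _),
    ← ENNReal.ofReal_mul (by positivity)]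
  apply ENNReal.ofReal_le_ofReal
  unfold green
  split_ifs with h
  · have hs : ‖((SignType.sign z.im : ℝ) : ℂ)‖ ≤ 1 := by
      rcases SignType.sign z.im with _ | _ | _ <;> simp
    have he : (I * m * z * q / p).re = -(m * |z.im| / |p|) * |q| := by
      have h1 : (I * m * z * q / p).re = -(m * z.im * q / p) := by
        rw [show I * m * z * q / p = (((m * q / p : ℝ) : ℂ)) * (I * z) by push_cast; ring]
        rw [Complex.re_ofReal_mul]
        simp
        ring
      have h2 : |z.im| * |q| * |p| = z.im * q * p := by
        rw [← abs_mul, ← abs_mul, abs_of_pos]; linarith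
      rw [h1]
      have hp' : 0 < |p| := abs_pos.mpr hp
      have h3 : |p| * |p| = p * p := abs_mul_abs_self p
      have : m * z.im * q / p = m * |z.im| / |p| * |q| := by
        rw [div_mul_eq_mul_div, div_eq_div_iff hp hp'.ne']
        apply mul_right_cancel₀ hp
        calc m * z.im * q * |p| * p = m * |p| * (z.im * q * p) := by ring
          _ = m * |z.im| * |q| * (|p| * |p|) := by rw [← h2]; ring
          _ = _ := by rw [h3]; ring
      linarith
    have e1 : ‖(1 : ℂ) * (SignType.sign z.im : ℂ) * (I * m / (|p| : ℝ)) *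
        exp (I * m * z * q / p)‖ ≤ m / |p| * Real.exp (-(m * |z.im| / |p|) * |q|) := by
      rw [norm_mul, norm_mul, Complex.norm_exp, he, one_mul]
      have : ‖(I * m / (|p| : ℝ) : ℂ)‖ = m / |p| := by
        simp [abs_of_pos hm]
      rw [this]
      have hs' : ‖(SignType.sign z.im : ℂ)‖ ≤ 1 := by
        rcases SignType.sign z.im with _ | _ | _ <;> simp
      have : 0 ≤ m / |p| := by positivity
      gcongr
      nlinarith
    calc _ ≤ (m / |p| * Real.exp (-(m * |z.im| / |p|) * |q|)) ^ 2 := by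
          gcongr
      _ = _ := by
          rw [mul_pow, div_pow, sq_abs, ← Real.exp_nat_mul]
          congr 2
          push_cast
          ring
  · simp
    positivity

theorem weightBound_green {m : ℝ} (hm : 0 < m) {z : ℂ} (hz : z.im ≠ 0) :
    WeightBound (absMeasure (-1)) (volume : Measure (ℝ × ℝ)) Prod.snd (green m z)
      (Real.toNNReal (m / |z.im|)) := by
  have hz' : 0 < |z.im| := abs_pos.mpr hz
  have hg := measurable_green m z
  refine Measure.le_iff.mpr fun s hs => ?_
  rw [Measure.map_apply measurable_snd hs, withDensity_apply _ (measurable_snd hs),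
    ← lintegral_indicator (measurable_snd hs), Measure.volume_eq_prod,
    lintegral_prod_symm _ (Measurable.aemeasurable
      (Measurable.indicator (by fun_prop) (measurable_snd hs))),
    Measure.smul_apply, absMeasure, withDensity_apply _ hs, smul_eq_mul,
    ← lintegral_const_mul _ (by fun_prop), ← lintegral_indicator hs]
  apply lintegral_mono_ae
  have h0 : ∀ᵐ p : ℝ, p ≠ 0 := by simp [ae_iff, measure_singleton]
  filter_upwards [h0] with p hp
  by_cases hps : p ∈ s
  · have hp' : 0 < |p| := abs_pos.mpr hp
    have : ∀ q : ℝ, (Prod.snd ⁻¹' s).indicator (fun y : ℝ × ℝ => ‖green m z y‖ₑ ^ 2) (q, p)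
        = ‖green m z (q, p)‖ₑ ^ 2 := fun q => Set.indicator_of_mem (by simpa using hps) _
    simp only [this, Set.indicator_of_mem hps]
    refine (lintegral_mono fun q => enorm_green_le hm q p hp).trans ?_
    rw [lintegral_const_mul _ (by fun_prop), lintegral_exp_neg_mul_abs (by positivity),
      ← ENNReal.ofReal_mul (by positivity), ENNReal.ofNNReal_toNNReal,
      ← ENNReal.ofReal_mul (by positivity)]
    apply ENNReal.ofReal_le_ofReal
    rw [← sq_abs p, zpow_neg_one]
    apply le_of_eq
    field_simp
  · have : ∀ q : ℝ, (Prod.snd ⁻¹' s).indicator (fun y : ℝ × ℝ => ‖green m z y‖ₑ ^ 2) (q, p)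
        = 0 := fun q => Set.indicator_of_notMem (by simpa using hps) _
    simp [this]

/-- The bounded operator `G_z : L²(ℝ, |p|⁻¹dp) → L²(ℝ²)`, `(G_z φ)(q,p) = g_z(q,p) φ(p)`. -/
def opG {m : ℝ} (hm : 0 < m) {z : ℂ} (hz : z.im ≠ 0) : LineL2 (-1) →L[ℂ] PhaseL2 :=
  weightedComp (weightBound_green hm hz) measurable_snd (measurable_green m z)

theorem weightBound_id {n n' : ℤ} {k : ℝ → ℂ} {C : ℝ≥0} (hk : Measurable k)
    (h : ∀ p : ℝ, |p| ^ n' * ‖k p‖ ^ 2 ≤ C * |p| ^ n) :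
    WeightBound (absMeasure n) (absMeasure n') id k C := by
  unfold WeightBound absMeasure
  rw [Measure.map_id, ← withDensity_mul _ (by fun_prop) (by fun_prop),
    ← withDensity_smul _ (by fun_prop)]
  refine withDensity_mono (Filter.Eventually.of_forall fun p => ?_)
  simp only [Pi.mul_apply, Pi.smul_apply, smul_eq_mul]
  rw [← ofReal_norm, ← ENNReal.ofReal_pow (norm_nonneg _),
    ← ENNReal.ofReal_mul (by positivity), ← ENNReal.ofReal_coe_nnreal,
    ← ENNReal.ofReal_mul (by positivity)]
  exact ENNReal.ofReal_le_ofReal (h p)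

theorem measurable_invAbs : Measurable fun p : ℝ => (((|p|)⁻¹ : ℝ) : ℂ) := by fun_prop

theorem weightBound_invAbs :
    WeightBound (absMeasure (-1)) (absMeasure 1) id (fun p => (((|p|)⁻¹ : ℝ) : ℂ)) 1 := by
  refine weightBound_id measurable_invAbs fun p => ?_
  rcases eq_or_ne p 0 with rfl | hp
  · simp
  · have hp' : 0 < |p| := abs_pos.mpr hp
    simp only [zpow_one, zpow_neg_one, norm_real, norm_inv, Real.norm_eq_abs, abs_abs,
      NNReal.coe_one, one_mul]
    apply le_of_eq
    field_simp

/-- The adjoint `T^* : L²(ℝ²) → L²(ℝ, |p|dp)` of `T : L²(ℝ, |p|⁻¹dp) → L²(ℝ²)` for the duality of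
`L²(ℝ, |p|⁻¹dp)` and `L²(ℝ, |p|dp)` induced by the scalar product of `L²(ℝ, dp)`:
`∫ conj(φ) (T^* f) dp = ⟪T φ, f⟫`. Hence `T^* f = |p|⁻¹ T† f`, with `T†` the Hilbert adjoint. -/
def dualAdjoint (T : LineL2 (-1) →L[ℂ] PhaseL2) : PhaseL2 →L[ℂ] LineL2 1 :=
  weightedComp weightBound_invAbs measurable_id measurable_invAbs ∘L
    ContinuousLinearMap.adjoint T

/-- `B(p) = b p²` for real `b`, and `B(p) = ∞` for `b = ∞`. -/
def coupling (b : OnePoint ℝ) (p : ℝ) : OnePoint ℝ :=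
  b.map fun b => b * p ^ 2

/-- `1 / x`, with `1 / ∞ = 0`. -/
def recip (x : OnePoint ℝ) : ℝ :=
  x.elim 0 fun x => 1 / x

/-- The function by which `Λ^B_z` multiplies: `1 / (1 / B(p) - sgn(Im z) i m / (2 |p|))`. -/
def symbolΛ (m : ℝ) (b : OnePoint ℝ) (z : ℂ) (p : ℝ) : ℂ :=
  1 / ((recip (coupling b p) : ℂ) - (SignType.sign z.im : ℂ) * (I * m / (2 * (|p| : ℝ))))

theorem measurable_symbolΛ (m : ℝ) (b : OnePoint ℝ) (z : ℂ) : Measurable (symbolΛ m b z) := by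
  have h : Measurable fun p => recip (coupling b p) := by
    induction b using OnePoint.rec with
    | infty => exact measurable_const
    | coe b =>
      change Measurable fun p : ℝ => 1 / (b * p ^ 2)
      fun_prop
  unfold symbolΛ
  fun_prop

theorem weightBound_symbolΛ {m : ℝ} (hm : 0 < m) (b : OnePoint ℝ) {z : ℂ} (hz : z.im ≠ 0) :
    WeightBound (absMeasure 1) (absMeasure (-1)) id (symbolΛ m b z)
      (Real.toNNReal ((2 / m) ^ 2)) := by
  refine weightBound_id (measurable_symbolΛ m b z) fun p => ?_
  rcases eq_or_ne p 0 with rfl | hp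
  · simp
  · have hp' : 0 < |p| := abs_pos.mpr hp
    have hk : ‖symbolΛ m b z p‖ ≤ 2 * |p| / m := by
      unfold symbolΛ
      rw [norm_div, norm_one, one_div]
      have hlow : m / (2 * |p|) ≤ ‖(recip (coupling b p) : ℂ) -
          (SignType.sign z.im : ℂ) * (I * m / (2 * (|p| : ℝ)))‖ := by
        refine le_trans (le_of_eq ?_) (Complex.abs_im_le_norm _)
        have e : (I * m / (2 * (|p| : ℝ)) : ℂ) = ((m / (2 * |p|) : ℝ) : ℂ) * I := by
          push_cast; ring
        have ht : 0 < m / (2 * |p|) := by positivity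
        rw [e]
        generalize m / (2 * |p|) = t at ht ⊢
        rcases lt_or_gt_of_ne hz with h | h
        · simp [sign_neg h, abs_of_pos ht]
        · simp [sign_pos h, abs_of_pos ht]
      calc _ ≤ (m / (2 * |p|))⁻¹ := inv_anti₀ (by positivity) hlow
        _ = _ := by rw [inv_div]
    rw [Real.coe_toNNReal _ (by positivity), zpow_one, zpow_neg_one]
    calc |p|⁻¹ * ‖symbolΛ m b z p‖ ^ 2 ≤ |p|⁻¹ * (2 * |p| / m) ^ 2 := by gcongr
      _ = _ := by field_simp

/-- The bounded operator `Λ^B_z : L²(ℝ, |p|dp) → L²(ℝ, |p|⁻¹dp)`. -/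
def opΛ {m : ℝ} (hm : 0 < m) (b : OnePoint ℝ) {z : ℂ} (hz : z.im ≠ 0) :
    LineL2 1 →L[ℂ] LineL2 (-1) :=
  weightedComp (weightBound_symbolΛ hm b hz) measurable_id (measurable_symbolΛ m b z)

/-- The Hamiltonian vector field `X₀(q,p) = (p/m, 0)` of a free particle. -/
def freeField (m : ℝ) (x : ℝ × ℝ) : ℝ × ℝ := (x.2 / m, 0)

/-- `X₀ · ∇f = h` in the sense of distributions on `ℝ²` (recall that `div X₀ = 0`). -/
def HasWeakTransport (m : ℝ) (f h : PhaseL2) : Prop :=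
  ∀ φ : ℝ × ℝ → ℂ, ContDiff ℝ ∞ φ → HasCompactSupport φ →
    ∫ x, f x * fderiv ℝ φ x (freeField m x) = -∫ x, h x * φ x

theorem integrable_mul_of_hasCompactSupport (f : PhaseL2) {φ : ℝ × ℝ → ℂ} (hφ : Continuous φ)
    (hc : HasCompactSupport φ) : Integrable fun x => f x * φ x :=
  (Lp.memLp f).integrable_mul (q := 2) (hφ.memLp_of_hasCompactSupport hc)

theorem integrable_mul_transport (m : ℝ) (f : PhaseL2) {φ : ℝ × ℝ → ℂ} (hφ : ContDiff ℝ ∞ φ)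
    (hc : HasCompactSupport φ) : Integrable fun x => f x * fderiv ℝ φ x (freeField m x) := by
  refine integrable_mul_of_hasCompactSupport f ?_ ?_
  · have h1 : Continuous (fderiv ℝ φ) := hφ.continuous_fderiv (by simp)
    have h2 : Continuous (freeField m) := by unfold freeField; fun_prop
    exact h1.clm_apply h2
  · exact (hc.fderiv ℝ).mono fun x hx => by
      contrapose! hx
      simp only [Function.mem_support, ne_eq, not_not] at hx ⊢
      simp [hx]

theorem HasWeakTransport.add {m : ℝ} {f h f' h' : PhaseL2} (H : HasWeakTransport m f h)
    (H' : HasWeakTransport m f' h') : HasWeakTransport m (f + f') (h + h') := by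
  intro φ hφ hc
  have e1 : ∫ x, (f + f' : PhaseL2) x * fderiv ℝ φ x (freeField m x) =
      ∫ x, (f x * fderiv ℝ φ x (freeField m x) + f' x * fderiv ℝ φ x (freeField m x)) := by
    refine integral_congr_ae ?_
    filter_upwards [Lp.coeFn_add f f'] with x hx
    rw [hx, Pi.add_apply, add_mul]
  have e2 : ∫ x, (h + h' : PhaseL2) x * φ x = ∫ x, (h x * φ x + h' x * φ x) := by
    refine integral_congr_ae ?_
    filter_upwards [Lp.coeFn_add h h'] with x hx
    rw [hx, Pi.add_apply, add_mul]
  rw [e1, e2, integral_add (integrable_mul_transport m f hφ hc)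
    (integrable_mul_transport m f' hφ hc),
    integral_add (integrable_mul_of_hasCompactSupport h hφ.continuous hc)
    (integrable_mul_of_hasCompactSupport h' hφ.continuous hc), H φ hφ hc, H' φ hφ hc, neg_add]

theorem HasWeakTransport.smul {m : ℝ} {f h : PhaseL2} (c : ℂ) (H : HasWeakTransport m f h) :
    HasWeakTransport m (c • f) (c • h) := by
  intro φ hφ hc
  have e1 : ∫ x, (c • f : PhaseL2) x * fderiv ℝ φ x (freeField m x) =
      ∫ x, c * (f x * fderiv ℝ φ x (freeField m x)) := by
    refine integral_congr_ae ?_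
    filter_upwards [Lp.coeFn_smul c f] with x hx
    rw [hx, Pi.smul_apply, smul_eq_mul, mul_assoc]
  have e2 : ∫ x, (c • h : PhaseL2) x * φ x = ∫ x, c * (h x * φ x) := by
    refine integral_congr_ae ?_
    filter_upwards [Lp.coeFn_smul c h] with x hx
    rw [hx, Pi.smul_apply, smul_eq_mul, mul_assoc]
  rw [e1, e2, integral_const_mul, integral_const_mul, H φ hφ hc, mul_neg]

theorem HasWeakTransport.eq_zero {m : ℝ} {h : PhaseL2} (H : HasWeakTransport m 0 h) : h = 0 := by
  have hloc : LocallyIntegrable (h : ℝ × ℝ → ℂ) volume :=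
    (Lp.memLp h).locallyIntegrable (by norm_num)
  have h0 := ae_eq_zero_of_integral_contDiff_smul_eq_zero hloc fun g hg hgc => by
    have hg' : ContDiff ℝ ∞ fun x => (g x : ℂ) := Complex.ofRealCLM.contDiff.comp hg
    have hgc' : HasCompactSupport fun x => (g x : ℂ) := hgc.comp_left Complex.ofReal_zero
    have e := H _ hg' hgc'
    have e1 : ∫ x, (0 : PhaseL2) x * fderiv ℝ (fun x => (g x : ℂ)) x (freeField m x) = 0 := by
      refine integral_eq_zero_of_ae ?_
      filter_upwards [Lp.coeFn_zero ℂ 2 (volume : Measure (ℝ × ℝ))] with x hx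
      simp
    rw [e1, eq_comm, neg_eq_zero] at e
    rw [← e]
    congr 1
    ext x
    rw [real_smul, mul_comm]
  exact Lp.eq_zero_iff_ae_eq_zero.mpr h0

/-- The graph of `f ↦ -i X₀ · ∇f` on the maximal domain `{f ∈ L² | X₀ · ∇f ∈ L²}`. -/
def freeGraph (m : ℝ) : Submodule ℂ (PhaseL2 × PhaseL2) where
  carrier := {x | ∃ h : PhaseL2, HasWeakTransport m x.1 h ∧ x.2 = -I • h}
  zero_mem' := ⟨0, fun φ _ _ => by
    have h0 := Lp.coeFn_zero ℂ 2 (volume : Measure (ℝ × ℝ))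
    rw [integral_eq_zero_of_ae, integral_eq_zero_of_ae, neg_zero]
    all_goals filter_upwards [h0] with x hx
    all_goals simp, by simp⟩
  add_mem' := by
    rintro x y ⟨h, H, e⟩ ⟨h', H', e'⟩
    exact ⟨h + h', H.add H', by rw [Prod.snd_add, e, e', smul_add]⟩
  smul_mem' := by
    rintro c x ⟨h, H, e⟩
    exact ⟨c • h, H.smul c, by rw [Prod.smul_snd, e, smul_comm]⟩

theorem freeGraph_single_valued (m : ℝ) (x : PhaseL2 × PhaseL2) (hx : x ∈ freeGraph m)
    (hx' : x.1 = 0) : x.2 = 0 := by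
  obtain ⟨h, H, e⟩ := hx
  rw [hx'] at H
  rw [e, H.eq_zero, smul_zero]

/-- The free operator `L₀ f = -i X₀ · ∇f` on its maximal domain. -/
def freeOp (m : ℝ) : PhaseL2 →ₗ.[ℂ] PhaseL2 := (freeGraph m).toLinearPMap

theorem freeOp_graph (m : ℝ) : (freeOp m).graph = freeGraph m :=
  Submodule.toLinearPMap_graph_eq _ (freeGraph_single_valued m)

/-- `φ` is the trace `p ↦ f(0,p)` of `f`: there is a representative of `f` which is continuous in
`q` for almost every `p`, and whose values at `q = 0` are those of `φ`. -/
def IsTrace (f : PhaseL2) (φ : LineL2 1) : Prop :=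
  ∃ F : ℝ × ℝ → ℂ, f =ᵐ[volume] F ∧ (∀ᵐ p : ℝ, Continuous fun q => F (q, p)) ∧
    φ =ᵐ[absMeasure 1] fun p => F (0, p)

theorem IsTrace.unique {f : PhaseL2} {φ ψ : LineL2 1} (h : IsTrace f φ) (h' : IsTrace f ψ) :
    φ = ψ := by
  obtain ⟨F, hF, cF, eF⟩ := h
  obtain ⟨G, hG, cG, eG⟩ := h'
  have hFG : ∀ᵐ x : ℝ × ℝ, F x = G x := by
    filter_upwards [hF, hG] with x h1 h2
    rw [← h1, h2]
  have hsw : ∀ᵐ x : ℝ × ℝ, F x.swap = G x.swap :=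
    (Measure.measurePreserving_swap (μ := (volume : Measure ℝ))
      (ν := (volume : Measure ℝ))).quasiMeasurePreserving.ae hFG
  have hsl : ∀ᵐ p : ℝ, ∀ᵐ q : ℝ, F (q, p) = G (q, p) := Measure.ae_ae_of_ae_prod hsw
  have h0 : ∀ᵐ p : ℝ, F (0, p) = G (0, p) := by
    filter_upwards [hsl, cF, cG] with p hp c1 c2
    exact congrFun (Continuous.ae_eq_iff_eq volume c1 c2 |>.mp hp) 0
  have h1 : ∀ᵐ p ∂(absMeasure 1), F (0, p) = G (0, p) :=
    (withDensity_absolutelyContinuous _ _).ae_le h0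
  refine Lp.ext ?_
  filter_upwards [eF, eG, h1] with p a b c
  rw [a, b, c]

open Classical in
/-- The trace map `γ : dom(L₀) → L²(ℝ, |p|dp)`, `(γ f)(p) = f(0,p)`. By `IsTrace.unique` there is
at most one linear map as required. -/
def traceMap (m : ℝ) : (freeOp m).domain →ₗ[ℂ] LineL2 1 :=
  if h : ∃ T : (freeOp m).domain →ₗ[ℂ] LineL2 1, ∀ u : (freeOp m).domain, IsTrace (u : PhaseL2) (T u) then h.choose else 0

/-- The bounded operator `R` is the resolvent `(T - z)⁻¹` of `T`. -/
def IsResolvent (T : PhaseL2 →ₗ.[ℂ] PhaseL2) (z : ℂ) (R : PhaseL2 →L[ℂ] PhaseL2) : Prop :=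
  (∀ f, ∃ h : R f ∈ T.domain, T ⟨R f, h⟩ - z • R f = f) ∧
    ∀ u : T.domain, R (T u - z • (u : PhaseL2)) = u

open Classical in
/-- The free resolvent `R⁰_z = (L₀ - z)⁻¹`. -/
def freeResolvent (m : ℝ) (z : ℂ) : PhaseL2 →L[ℂ] PhaseL2 :=
  if h : ∃ R, IsResolvent (freeOp m) z R then h.choose else 0

/-- The restriction of `L₀` to `ker γ`. -/
def freeOpKer (m : ℝ) : PhaseL2 →ₗ.[ℂ] PhaseL2 :=
  (freeOp m).domRestrict ((LinearMap.ker (traceMap m)).map (freeOp m).domain.subtype)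

theorem conj_im_ne_zero {z : ℂ} (hz : z.im ≠ 0) : (conj z).im ≠ 0 := by
  rwa [conj_im, neg_ne_zero]

/-- `R^B_z = R⁰_z + G_z Π' Λ^B_z Π' G_{z̄}^*`. -/
def kreinResolvent {m : ℝ} (hm : 0 < m) (b : OnePoint ℝ) {z : ℂ} (hz : z.im ≠ 0) :
    PhaseL2 →L[ℂ] PhaseL2 :=
  freeResolvent m z +
    opG hm hz ∘L oddProj (-1) ∘L opΛ hm b hz ∘L oddProj 1 ∘L
      dualAdjoint (opG hm (conj_im_ne_zero hz))

end DeltaPrime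

end

open DeltaPrime MeasureTheory
open scoped ComplexConjugate

/-
Krein's resolvent formula. `iL₀` generates translation along the flow `t ↦ (q + tp/m, p)`, so
`R⁰_z` is the Laplace transform of this unitary group and `G_z` spreads a density on the line
`q = 0` along the flow, with the same kernel. The Gram operator `(z - w) G_{w̄}† G_z` is
multiplication by a constant depending only on the signs of `Im z` and `Im w`, and `Λ^B_z |p|⁻¹`
is multiplication by an even function whose reciprocal changes by the matching constant; hence
`R^B_z` satisfies the resolvent identity. It is injective, since the range of `G_z` meets
`dom(L₀)` only in `0`, so it is the resolvent of an operator `L_B`, and `(R^B_z)† = R^B_{z̄}` makes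
`L_B` self-adjoint.
-/

noncomputable section

namespace DeltaPrime

open MeasureTheory Complex
open scoped ENNReal NNReal ContDiff ComplexConjugate

section Resolvent

variable {𝕜 E : Type*} [NontriviallyNormedField 𝕜] [NormedAddCommGroup E] [NormedSpace 𝕜 E]
  {T T' : E →ₗ.[𝕜] E} {z w : 𝕜} {R S : E →L[𝕜] E}

/-- The bounded operator `R` is the resolvent `(T - z)⁻¹` of `T`, in an arbitrary normed space. -/
def IsResolventAt (T : E →ₗ.[𝕜] E) (z : 𝕜) (R : E →L[𝕜] E) : Prop :=
  (∀ f, ∃ h : R f ∈ T.domain, T ⟨R f, h⟩ - z • R f = f) ∧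
    ∀ u : T.domain, R (T u - z • (u : E)) = u

theorem IsResolventAt.mem_domain (h : IsResolventAt T z R) (f : E) : R f ∈ T.domain :=
  (h.1 f).1

theorem IsResolventAt.map_apply (h : IsResolventAt T z R) (f : E) :
    T ⟨R f, h.mem_domain f⟩ = f + z • R f :=
  sub_eq_iff_eq_add.1 (h.1 f).2

theorem IsResolventAt.eq_zero_of_apply_eq_zero (h : IsResolventAt T z R) {f : E} (hf : R f = 0) :
    f = 0 := by
  have h0 : (⟨R f, h.mem_domain f⟩ : T.domain) = 0 := Subtype.ext hf
  have := h.map_apply f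
  rw [h0, T.map_zero, hf, smul_zero, add_zero] at this
  exact this.symm

theorem IsResolventAt.apply_sub_apply (hz : IsResolventAt T z R) (hw : IsResolventAt T w S)
    (f : E) : R f - S f = (z - w) • S (R f) := by
  have h := hw.2 ⟨R f, hz.mem_domain f⟩
  rw [hz.map_apply, map_sub, map_add, map_smul, map_smul] at h
  linear_combination (norm := module) -h

theorem IsResolventAt.unique (h : IsResolventAt T z R) (h' : IsResolventAt T z S) : R = S := by
  ext1 f
  simpa [sub_eq_zero] using h.apply_sub_apply h' f

theorem IsResolventAt.add_injective (h : IsResolventAt T z R) {A : E →L[𝕜] E}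
    (hA : ∀ f, A f ∈ T.domain → A f = 0) : Function.Injective (R + A) := by
  refine (injective_iff_map_eq_zero _).2 fun f hf => ?_
  have hAf : A f = -R f := eq_neg_of_add_eq_zero_right hf
  have h0 := hA f (hAf ▸ neg_mem (h.mem_domain f))
  exact h.eq_zero_of_apply_eq_zero (neg_eq_zero.1 (hAf ▸ h0))

/-- An injective pseudo-resolvent is a resolvent: the operator is `(R z₀)⁻¹ + z₀`. -/
theorem exists_isResolventAt_of_resolvent_identity {ι : Type*} {z : ι → 𝕜} {R : ι → E →L[𝕜] E}
    {i₀ : ι} (hinj : Function.Injective (R i₀))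
    (hR : ∀ i j f, R i f - R j f = (z i - z j) • R j (R i f)) :
    ∃ T : E →ₗ.[𝕜] E, ∀ i, IsResolventAt T (z i) (R i) := by
  let e := LinearEquiv.ofInjective (R i₀).toLinearMap hinj
  let T : E →ₗ.[𝕜] E :=
    { domain := LinearMap.range (R i₀).toLinearMap
      toFun := e.symm.toLinearMap + z i₀ • (LinearMap.range (R i₀).toLinearMap).subtype }
  have hT : ∀ (a : E) (u : T.domain), (u : E) = R i₀ a → T u = a + z i₀ • R i₀ a := by
    intro a u hu
    obtain rfl : u = e a := Subtype.ext hu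
    change e.symm (e a) + z i₀ • R i₀ a = _
    rw [e.symm_apply_apply]
  refine ⟨T, fun i => ⟨fun f => ?_, fun u => ?_⟩⟩
  · have hf : R i f = R i₀ (f + (z i - z i₀) • R i f) := by
      rw [map_add, map_smul, ← hR i i₀ f, add_sub_cancel]
    refine ⟨⟨_, hf.symm⟩, ?_⟩
    rw [hT _ _ hf, ← hf]
    module
  · obtain ⟨a, ha⟩ := u.2
    replace ha : (u : E) = R i₀ a := ha.symm
    have hu : T u - z i • (u : E) = a + (z i₀ - z i) • R i₀ a := by
      rw [hT a u ha, ha]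
      module
    rw [hu, ha, map_add, map_smul, ← hR i₀ i a, add_sub_cancel]

variable {A : T.domain → E}

theorem IsResolventAt.mem_domain_iff_exists_add (h : IsResolventAt T z R)
    (h' : IsResolventAt T' z S) (hA : ∀ u, S (T u - z • (u : E)) = u + A u) (f : E) :
    f ∈ T'.domain ↔ ∃ u : T.domain, f = u + A u := by
  constructor
  · intro hf
    obtain ⟨hu, e⟩ := h.1 (T' ⟨f, hf⟩ - z • f)
    exact ⟨⟨_, hu⟩, by rw [← hA, e]; exact (h'.2 ⟨f, hf⟩).symm⟩
  · rintro ⟨u, rfl⟩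
    exact hA u ▸ h'.mem_domain _

theorem IsResolventAt.sub_smul_eq_of_eq_add (h' : IsResolventAt T' z S)
    (hA : ∀ u, S (T u - z • (u : E)) = u + A u) {f : T'.domain} {u : T.domain}
    (hf : (f : E) = u + A u) : T' f - z • (f : E) = T u - z • (u : E) := by
  obtain ⟨h1, e⟩ := h'.1 (T u - z • (u : E))
  obtain rfl : f = ⟨_, h1⟩ := Subtype.ext (hf.trans (hA u).symm)
  exact e

theorem IsResolventAt.le_of_eq_zero {T₀ : E →ₗ.[𝕜] E} (hT₀ : T₀ ≤ T) (h' : IsResolventAt T' z S)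
    (hA : ∀ u, S (T u - z • (u : E)) = u + A u)
    (h0 : ∀ u : T₀.domain, A ⟨u, hT₀.1 u.2⟩ = 0) : T₀ ≤ T' := by
  have hS : ∀ u : T₀.domain, (u : E) = (⟨u, hT₀.1 u.2⟩ : T.domain) + A ⟨u, hT₀.1 u.2⟩ :=
    fun u => by rw [h0, add_zero]
  refine ⟨fun f hf => ?_, fun x y hxy => ?_⟩
  · have h : f = _ := (hS ⟨f, hf⟩).trans (hA _).symm
    rw [h]
    exact h'.mem_domain _
  · have h := h'.sub_smul_eq_of_eq_add hA (hxy.symm.trans (hS x))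
    rw [← hxy, sub_left_inj] at h
    rw [h, hT₀.2 (x := x) (y := ⟨x, hT₀.1 x.2⟩) rfl]

/-- The algebra behind Krein's resolvent formula; `Θ` stands for the inverse of the difference of
the boundary parameter and the Weyl function. -/
theorem krein_resolvent_identity {V W : Type*} [NormedAddCommGroup V] [NormedSpace 𝕜 V]
    [NormedAddCommGroup W] [NormedSpace 𝕜 W] {Gz Gw : V →L[𝕜] E} {Gz' Gw' : E →L[𝕜] W}
    {Θz Θw : W →L[𝕜] V}
    (hR : ∀ f, R f - S f = (z - w) • S (R f))
    (hG : ∀ v, Gz v - Gw v = (z - w) • S (Gz v))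
    (hG' : ∀ f, Gz' f - Gw' f = (z - w) • Gw' (R f))
    (hΘ : ∀ x, Θz x - Θw x = (z - w) • Θw (Gw' (Gz (Θz x)))) (f : E) :
    (R + Gz ∘L Θz ∘L Gz') f - (S + Gw ∘L Θw ∘L Gw') f =
      (z - w) • (S + Gw ∘L Θw ∘L Gw') ((R + Gz ∘L Θz ∘L Gz') f) := by
  have h1 := congrArg (fun x => Gw (Θw x)) (hG' f)
  have h2 := congrArg Gw (hΘ (Gz' f))
  simp only [map_sub, map_smul] at h1 h2
  simp only [add_apply, ContinuousLinearMap.comp_apply, map_add, smul_add,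
    ← hR, ← hG, ← h1, ← h2]
  abel

end Resolvent

section AdjointResolvents

variable {𝕜 H : Type*} [RCLike 𝕜] [NormedAddCommGroup H] [InnerProductSpace 𝕜 H] [CompleteSpace H]
  {T : H →ₗ.[𝕜] H} {z : 𝕜} {R : H →L[𝕜] H}

theorem IsResolventAt.dense_domain (h : IsResolventAt T z R)
    (h' : IsResolventAt T (conj z) R.adjoint) : Dense (T.domain : Set H) := by
  rw [Submodule.dense_iff_topologicalClosure_eq_top, Submodule.topologicalClosure_eq_top_iff,
    Submodule.eq_bot_iff]
  refine fun g hg => h'.eq_zero_of_apply_eq_zero (ext_inner_left 𝕜 fun f => ?_)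
  rw [inner_zero_right, R.adjoint_inner_right]
  exact (Submodule.mem_orthogonal _ _).1 hg _ (h.mem_domain f)

theorem IsResolventAt.isFormalAdjoint (h : IsResolventAt T z R)
    (h' : IsResolventAt T (conj z) R.adjoint) : T.IsFormalAdjoint T := by
  intro y x
  have := R.adjoint_inner_right (T y - z • (y : H)) (T x - conj z • (x : H))
  rw [h.2, h'.2, inner_sub_left, inner_sub_right, inner_smul_left, inner_smul_right] at this
  linear_combination this

theorem IsResolventAt.adjoint_domain_le (h : IsResolventAt T z R)
    (h' : IsResolventAt T (conj z) R.adjoint) : T.adjoint.domain ≤ T.domain := by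
  intro y hy
  have hy' : R.adjoint (T.adjoint ⟨y, hy⟩ - conj z • y) = y := by
    refine ext_inner_right 𝕜 fun f => ?_
    have := LinearPMap.adjoint_isFormalAdjoint (h.dense_domain h') ⟨y, hy⟩ ⟨R f, h.mem_domain f⟩
    rw [h.map_apply, inner_add_right, inner_smul_right] at this
    rw [R.adjoint_inner_left, inner_sub_left, inner_smul_left, this, RCLike.conj_conj]
    exact add_sub_cancel_right _ _
  exact hy' ▸ h'.mem_domain _

theorem IsResolventAt.isSelfAdjoint (h : IsResolventAt T z R)
    (h' : IsResolventAt T (conj z) R.adjoint) : IsSelfAdjoint T := by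
  have hle : T ≤ T.adjoint := (h.isFormalAdjoint h').le_adjoint (h.dense_domain h')
  rw [LinearPMap.isSelfAdjoint_def]
  exact (LinearPMap.eq_of_le_of_domain_eq hle
    (le_antisymm hle.1 (h.adjoint_domain_le h'))).symm

end AdjointResolvents

section ResolventKernel

/-- The sign of the imaginary part, as a complex number. -/
def imSign (z : ℂ) : ℂ := SignType.sign z.im

theorem imSign_of_pos {z : ℂ} (hz : 0 < z.im) : imSign z = 1 := by simp [imSign, sign_pos hz]

theorem imSign_of_neg {z : ℂ} (hz : z.im < 0) : imSign z = -1 := by simp [imSign, sign_neg hz]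

theorem imSign_ne_zero {z : ℂ} (hz : z.im ≠ 0) : imSign z ≠ 0 := by
  rcases lt_or_gt_of_ne hz with h | h
  · simp [imSign_of_neg h]
  · simp [imSign_of_pos h]

theorem imSign_neg (z : ℂ) : imSign (-z) = -imSign z := by
  simp [imSign, Left.sign_neg]

theorem imSign_conj (z : ℂ) : imSign (conj z) = -imSign z := by
  simp [imSign, Left.sign_neg]

theorem conj_imSign (z : ℂ) : conj (imSign z) = imSign z := by
  rw [imSign]
  cases SignType.sign z.im <;> simp

theorem norm_imSign_le (z : ℂ) : ‖imSign z‖ ≤ 1 := by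
  rw [imSign]
  cases SignType.sign z.im <;> simp

/-- The kernel of the resolvent `(-i d/dt - z)⁻¹` on the line. In flow time, the function `green`
is this kernel, and the resolvent of the generator of a unitary group is its integral against the
group. -/
def resolventKernel (z : ℂ) (t : ℝ) : ℂ :=
  if 0 < t * z.im then imSign z * I * exp (I * z * t) else 0

theorem resolventKernel_of_pos {z : ℂ} (hz : 0 < z.im) :
    resolventKernel z = (Set.Ioi 0).indicator fun t : ℝ => I * exp (I * z * t) := by
  ext t
  simp only [resolventKernel, mul_pos_iff_of_pos_right hz, imSign_of_pos hz, one_mul,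
    Set.indicator, Set.mem_Ioi]

theorem resolventKernel_neg_neg (z : ℂ) (t : ℝ) :
    resolventKernel (-z) (-t) = -resolventKernel z t := by
  simp only [resolventKernel, neg_im, neg_mul_neg, imSign_neg]
  split_ifs <;> simp

theorem conj_resolventKernel (z : ℂ) (t : ℝ) :
    conj (resolventKernel z t) = resolventKernel (conj z) (-t) := by
  simp only [resolventKernel, conj_im, neg_mul_neg, imSign_conj]
  split_ifs
  · simp [conj_imSign, ← exp_conj]
  · simp

theorem measurable_resolventKernel (z : ℂ) : Measurable (resolventKernel z) :=
  Measurable.ite (measurableSet_lt measurable_const (by fun_prop)) (by fun_prop) measurable_const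

theorem norm_resolventKernel_le (z : ℂ) (t : ℝ) :
    ‖resolventKernel z t‖ ≤ Real.exp (-|z.im| * |t|) := by
  rw [resolventKernel]
  split_ifs with h
  · have hre : (I * z * t).re = -|z.im| * |t| := by
      rw [neg_mul, ← abs_mul, mul_comm z.im, abs_of_pos h]
      simp [mul_comm]
    rw [norm_mul, norm_mul, norm_I, mul_one, Complex.norm_exp, hre]
    exact mul_le_of_le_one_left (Real.exp_nonneg _) (norm_imSign_le z)
  · simpa using Real.exp_nonneg _

theorem integrable_resolventKernel {z : ℂ} (hz : z.im ≠ 0) : Integrable (resolventKernel z) := by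
  have hexp : Integrable fun t : ℝ => Real.exp (-|z.im| * |t|) := by
    rw [← lintegral_ofReal_ne_top_iff_integrable (by fun_prop)
      (Filter.Eventually.of_forall fun t => (Real.exp_nonneg _)),
      lintegral_exp_neg_mul_abs (abs_pos.2 hz)]
    exact ENNReal.ofReal_ne_top
  exact hexp.mono' (measurable_resolventKernel z).aestronglyMeasurable
    (Filter.Eventually.of_forall (norm_resolventKernel_le z))

theorem re_I_mul_neg {z : ℂ} (hz : 0 < z.im) : (I * z).re < 0 := by simpa using hz

section IntegrationByParts

variable {E : Type*} [NormedAddCommGroup E] [NormedSpace ℂ E] {z : ℂ}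

theorem integral_resolventKernel_smul_of_pos (hz : 0 < z.im) (F : ℝ → E) :
    ∫ t, resolventKernel z t • F t = I • ∫ t in Set.Ioi (0 : ℝ), exp (I * z * t) • F t := by
  simp only [resolventKernel_of_pos hz, ← Set.indicator_smul_apply_left, mul_smul]
  rw [integral_indicator measurableSet_Ioi, integral_smul]

theorem integral_resolventKernel_neg_smul (F : ℝ → E) :
    ∫ t, resolventKernel (-z) t • F (-t) = -∫ t, resolventKernel z t • F t := by
  rw [← integral_neg_eq_self, ← integral_neg]
  simp only [resolventKernel_neg_neg, neg_neg, neg_smul]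

theorem tendsto_exp_I_mul_smul_atTop (hz : 0 < z.im) {F : ℝ → E} {C : ℝ} (hF : ∀ t, ‖F t‖ ≤ C) :
    Filter.Tendsto (fun t : ℝ => exp (I * z * t) • F t) Filter.atTop (nhds 0) := by
  refine squeeze_zero_norm (a := fun t => Real.exp (-z.im * t) * C) (fun t => ?_) ?_
  · have hre : (I * z * t).re = -z.im * t := by simp
    rw [norm_smul, Complex.norm_exp, hre]
    gcongr
    exact hF t
  · simpa using (Real.tendsto_exp_atBot.comp
      (Filter.tendsto_id.const_mul_atTop_of_neg (neg_neg_of_pos hz))).mul_const C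

theorem integral_resolventKernel_smul_deriv_of_pos [CompleteSpace E] (hz : 0 < z.im)
    {F F' : ℝ → E} {C C' : ℝ} (hderiv : ∀ t, HasDerivAt F (F' t) t) (hF : ∀ t, ‖F t‖ ≤ C)
    (hF' : ∀ t, ‖F' t‖ ≤ C') :
    ∫ t, resolventKernel z t • F' t = -I • (F 0 + z • ∫ t, resolventKernel z t • F t) := by
  have hexp : IntegrableOn (fun t : ℝ => exp (I * z * t)) (Set.Ioi 0) :=
    integrableOn_exp_mul_complex_Ioi (re_I_mul_neg hz) 0
  have hcont : Continuous F := continuous_iff_continuousAt.2 fun t => (hderiv t).continuousAt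
  have hF'meas : StronglyMeasurable F' :=
    funext (fun t => (hderiv t).deriv) ▸ stronglyMeasurable_deriv F
  have hint : IntegrableOn (fun t : ℝ => (I * z) • exp (I * z * t) • F t) (Set.Ioi 0) :=
    (hexp.smul_bdd C hcont.aestronglyMeasurable (Filter.Eventually.of_forall hF)).smul (I * z)
  have hint' : IntegrableOn (fun t : ℝ => exp (I * z * t) • F' t) (Set.Ioi 0) :=
    hexp.smul_bdd C' hF'meas.aestronglyMeasurable (Filter.Eventually.of_forall hF')
  have hprod : ∀ t ∈ Set.Ici (0 : ℝ), HasDerivAt (fun t : ℝ => exp (I * z * t) • F t)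
      ((I * z) • exp (I * z * t) • F t + exp (I * z * t) • F' t) t := fun t _ => by
    have h := ((hasDerivAt_id (t : ℂ)).const_mul (I * z)).cexp.comp_ofReal
    refine (h.smul (hderiv t)).congr_deriv ?_
    simp only [id, mul_one, smul_smul]
    rw [add_comm, mul_comm]
  have key := integral_Ioi_of_hasDerivAt_of_tendsto' hprod (hint.add hint')
    (tendsto_exp_I_mul_smul_atTop hz hF)
  rw [integral_add hint hint', integral_smul, Complex.ofReal_zero, mul_zero, Complex.exp_zero,
    one_smul, zero_sub] at key
  rw [integral_resolventKernel_smul_of_pos hz, integral_resolventKernel_smul_of_pos hz,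
    eq_sub_of_add_eq' key]
  module

theorem integral_resolventKernel_smul_deriv [CompleteSpace E] (hz : z.im ≠ 0) {F F' : ℝ → E}
    {C C' : ℝ} (hderiv : ∀ t, HasDerivAt F (F' t) t) (hF : ∀ t, ‖F t‖ ≤ C)
    (hF' : ∀ t, ‖F' t‖ ≤ C') :
    ∫ t, resolventKernel z t • F' t = -I • (F 0 + z • ∫ t, resolventKernel z t • F t) := by
  rcases lt_or_gt_of_ne hz with hneg | hpos
  · have hderiv' : ∀ t, HasDerivAt (fun t => F (-t)) (-F' (-t)) t := fun t => by
      simpa [Function.comp_def] using (hderiv (-t)).scomp t (hasDerivAt_neg t)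
    have h := integral_resolventKernel_smul_deriv_of_pos (z := -z) (by simpa using hneg) hderiv'
      (fun t => hF (-t)) (fun t => (norm_neg _).trans_le (hF' (-t)))
    simpa only [smul_neg, integral_neg, integral_resolventKernel_neg_smul, neg_neg, neg_zero,
      neg_smul] using h
  · exact integral_resolventKernel_smul_deriv_of_pos hpos hderiv hF hF'

end IntegrationByParts

theorem mul_integral_resolventKernel_neg_mul_of_pos_of_neg {z w : ℂ} (hz : 0 < z.im)
    (hw : w.im < 0) : (z - w) * ∫ t, resolventKernel w (-t) * resolventKernel z t = I := by
  have hzw : 0 < (z - w).im := by simpa using hw.trans hz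
  have hne : z - w ≠ 0 := fun h => by simp [h] at hzw
  have hprod : ∀ t, resolventKernel w (-t) * resolventKernel z t =
      (Set.Ioi 0).indicator (fun t : ℝ => exp (I * (z - w) * t)) t := fun t => by
    simp only [resolventKernel, neg_mul, Left.neg_pos_iff, Set.indicator, Set.mem_Ioi,
      mul_pos_iff_of_pos_right hz, mul_neg_iff, hw, hw.not_gt, and_true, and_false, or_false,
      imSign_of_pos hz, imSign_of_neg hw]
    split_ifs with ht
    · have hexp : exp (I * (z - w) * t) = exp (I * w * (-t : ℝ)) * exp (I * z * t) := by
        rw [← Complex.exp_add]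
        push_cast
        ring_nf
      rw [hexp]
      linear_combination -(exp (I * w * (-t : ℝ)) * exp (I * z * t)) * I_sq
    · rw [mul_zero]
  simp only [hprod]
  rw [integral_indicator measurableSet_Ioi, integral_exp_mul_complex_Ioi (re_I_mul_neg hzw)]
  field_simp
  simp

/-- The Weyl function of `-i d/dt` at the origin is `imSign z * (I / 2)`. -/
theorem mul_integral_resolventKernel_neg_mul {z w : ℂ} (hz : z.im ≠ 0) (hw : w.im ≠ 0) :
    (z - w) * ∫ t, resolventKernel w (-t) * resolventKernel z t =
      (imSign z - imSign w) * (I / 2) := by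
  have hsame : 0 < z.im * w.im → ∀ t, resolventKernel w (-t) * resolventKernel z t = 0 := by
    intro h t
    simp only [resolventKernel, ite_mul, mul_ite, mul_zero, zero_mul]
    split_ifs with h1 h2 <;>
      first | rfl | nlinarith [mul_pos h1 h2, mul_nonneg (sq_nonneg t) h.le]
  rcases lt_or_gt_of_ne hz with hz | hz <;> rcases lt_or_gt_of_ne hw with hw | hw
  · simp [hsame (mul_pos_of_neg_of_neg hz hw), imSign_of_neg, hz, hw]
  · have h := mul_integral_resolventKernel_neg_mul_of_pos_of_neg hw hz
    rw [← integral_neg_eq_self] at h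
    simp only [neg_neg, mul_comm (resolventKernel z _)] at h
    rw [imSign_of_neg hz, imSign_of_pos hw]
    linear_combination -h
  · rw [mul_integral_resolventKernel_neg_mul_of_pos_of_neg hz hw, imSign_of_pos hz,
      imSign_of_neg hw]
    ring
  · simp [hsame (mul_pos hz hw), imSign_of_pos, hz, hw]

end ResolventKernel

section IsometryIntegral

variable {α E : Type*} [MeasurableSpace α] {μ : Measure α} [NormedAddCommGroup E]
  [NormedSpace ℂ E] {V : α → E →ₗᵢ[ℂ] E} {k : α → ℂ}

theorem integrable_smul_isometry (hV : ∀ v, AEStronglyMeasurable (fun t => V t v) μ)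
    (hk : Integrable k μ) (v : E) : Integrable (fun t => k t • V t v) μ :=
  hk.smul_bdd ‖v‖ (hV v) (Filter.Eventually.of_forall fun t => ((V t).norm_map v).le)

/-- The operator `v ↦ ∫ k(t) V(t) v dμ(t)`, for a family of isometries `V` and an integrable
weight `k`. The resolvents of the generator of a unitary group are of this form. -/
def isometryIntegral (hV : ∀ v, AEStronglyMeasurable (fun t => V t v) μ) (hk : Integrable k μ) :
    E →L[ℂ] E :=
  LinearMap.mkContinuous
    { toFun := fun v => ∫ t, k t • V t v ∂μ
      map_add' := fun v w => by
        simp only [map_add, smul_add]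
        exact integral_add (integrable_smul_isometry hV hk v) (integrable_smul_isometry hV hk w)
      map_smul' := fun c v => by
        simp only [map_smul, smul_comm _ c, RingHom.id_apply, integral_smul] }
    (∫ t, ‖k t‖ ∂μ)
    (fun v => by
      rw [← integral_mul_const]
      exact norm_integral_le_of_norm_le (hk.norm.mul_const ‖v‖)
        (Filter.Eventually.of_forall fun t => by rw [norm_smul, (V t).norm_map]))

variable (hV : ∀ v, AEStronglyMeasurable (fun t => V t v) μ) (hk : Integrable k μ)

theorem isometryIntegral_apply (v : E) : isometryIntegral hV hk v = ∫ t, k t • V t v ∂μ := rfl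

theorem map_isometryIntegral [CompleteSpace E] (ℓ : E →L[ℂ] ℂ) (v : E) :
    ℓ (isometryIntegral hV hk v) = ∫ t, k t * ℓ (V t v) ∂μ := by
  rw [isometryIntegral_apply, ← ℓ.integral_comp_comm (integrable_smul_isometry hV hk v)]
  simp only [map_smul, smul_eq_mul]

end IsometryIntegral

theorem adjoint_isometryIntegral {α H : Type*} [MeasurableSpace α] {μ : Measure α}
    [NormedAddCommGroup H] [InnerProductSpace ℂ H] [CompleteSpace H] {V W : α → H →ₗᵢ[ℂ] H}
    {k k' : α → ℂ}
    (hV : ∀ v, AEStronglyMeasurable (fun t => V t v) μ)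
    (hW : ∀ v, AEStronglyMeasurable (fun t => W t v) μ) (hk : Integrable k μ)
    (hk' : Integrable k' μ) (hVW : ∀ t v w, inner ℂ (V t v) w = inner ℂ v (W t w))
    (hkk' : ∀ t, conj (k t) = k' t) :
    ContinuousLinearMap.adjoint (isometryIntegral hV hk) = isometryIntegral hW hk' := by
  refine (ContinuousLinearMap.eq_adjoint_iff _ _).2 (fun w v => ?_) |>.symm
  rw [← inner_conj_symm, ← innerSL_apply_apply ℂ v, ← innerSL_apply_apply ℂ w,
    map_isometryIntegral, map_isometryIntegral, ← integral_conj]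
  refine integral_congr_ae (Filter.Eventually.of_forall fun t => ?_)
  simp only [innerSL_apply_apply]
  rw [map_mul, ← hkk', conj_conj, ← hVW, inner_conj_symm]

theorem map_isometryIntegral_resolventKernel_of_hasDerivAt {E : Type*} [NormedAddCommGroup E]
    [NormedSpace ℂ E] [CompleteSpace E] {U : ℝ → E →ₗᵢ[ℂ] E} {z : ℂ} (hz : z.im ≠ 0)
    (hU : ∀ v, AEStronglyMeasurable (fun t => U (-t) v)) {ℓ ℓ' : E →L[ℂ] ℂ} {f g : E}
    (hd : ∀ t, HasDerivAt (fun t => ℓ (U (-t) f)) (ℓ' (U (-t) g)) t) :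
    ℓ' (isometryIntegral hU (integrable_resolventKernel hz) g) =
      -I * (ℓ (U 0 f) + z * ℓ (isometryIntegral hU (integrable_resolventKernel hz) f)) := by
  have hbound : ∀ (k : E →L[ℂ] ℂ) v t, ‖k (U (-t) v)‖ ≤ ‖k‖ * ‖v‖ := fun k v t =>
    (k.le_opNorm _).trans_eq (by rw [(U (-t)).norm_map])
  have h := integral_resolventKernel_smul_deriv hz hd (hbound ℓ f) (hbound ℓ' g)
  simpa only [map_isometryIntegral, neg_zero, smul_eq_mul] using h

section Flow

/-- The flow `(q, p) ↦ (q + t p / m, p)` of a free particle. -/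
def freeFlow (m t : ℝ) (x : ℝ × ℝ) : ℝ × ℝ := (x.1 + t * (x.2 / m), x.2)

theorem freeFlow_zero (m : ℝ) (x : ℝ × ℝ) : freeFlow m 0 x = x := by simp [freeFlow]

theorem freeFlow_freeFlow (m s t : ℝ) (x : ℝ × ℝ) :
    freeFlow m s (freeFlow m t x) = freeFlow m (s + t) x := by
  simp only [freeFlow, Prod.mk.injEq, and_true]; ring

theorem freeFlow_neg_freeFlow (m t : ℝ) (x : ℝ × ℝ) : freeFlow m (-t) (freeFlow m t x) = x := by
  rw [freeFlow_freeFlow, neg_add_cancel, freeFlow_zero]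

theorem freeFlow_freeFlow_neg (m t : ℝ) (x : ℝ × ℝ) : freeFlow m t (freeFlow m (-t) x) = x := by
  rw [freeFlow_freeFlow, add_neg_cancel, freeFlow_zero]

theorem continuous_freeFlow_uncurry (m : ℝ) :
    Continuous fun y : ℝ × (ℝ × ℝ) => freeFlow m y.1 y.2 := by
  unfold freeFlow; fun_prop

theorem continuous_freeFlow (m t : ℝ) : Continuous (freeFlow m t) := by
  unfold freeFlow; fun_prop

theorem contDiff_freeFlow (m t : ℝ) : ContDiff ℝ ∞ (freeFlow m t) := by
  unfold freeFlow; fun_prop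

theorem hasDerivAt_freeFlow (m t : ℝ) (x : ℝ × ℝ) :
    HasDerivAt (fun t => freeFlow m t x) (freeField m x) t := by
  unfold freeFlow freeField
  refine HasDerivAt.prodMk ?_ (hasDerivAt_const _ _)
  simpa using ((hasDerivAt_id t).mul_const (x.2 / m)).const_add x.1

theorem measurePreserving_freeFlow (m t : ℝ) :
    MeasurePreserving (freeFlow m t) (volume : Measure (ℝ × ℝ)) volume := by
  have h1 : MeasurePreserving (fun y : ℝ × ℝ => (id y.1, y.2 + t * (y.1 / m)))
      ((volume : Measure ℝ).prod volume) ((volume : Measure ℝ).prod volume) :=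
    (MeasurePreserving.id (volume : Measure ℝ)).skew_product
      (g := fun p q => q + t * (p / m)) (by unfold Function.uncurry; fun_prop)
      (Filter.Eventually.of_forall fun p => map_add_right_eq_self volume _)
  have h2 := Measure.measurePreserving_swap (μ := (volume : Measure ℝ))
    (ν := (volume : Measure ℝ))
  exact (h2.comp h1).comp h2

/-- `f ↦ f ∘ Φ_t` on `L²(ℝ²)`, with `Φ_t` the free flow. -/
def flowOp (m t : ℝ) : PhaseL2 →ₗᵢ[ℂ] PhaseL2 :=
  Lp.compMeasurePreservingₗᵢ ℂ (freeFlow m t) (measurePreserving_freeFlow m t)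

theorem flowOp_coeFn (m t : ℝ) (f : PhaseL2) :
    flowOp m t f =ᵐ[volume] fun x => f (freeFlow m t x) :=
  Lp.coeFn_compMeasurePreserving f (measurePreserving_freeFlow m t)

theorem flowOp_zero (m : ℝ) (f : PhaseL2) : flowOp m 0 f = f := by
  refine Lp.ext ((flowOp_coeFn m 0 f).trans ?_)
  simp only [freeFlow_zero, Filter.EventuallyEq.refl]

theorem flowOp_flowOp_neg (m t : ℝ) (f : PhaseL2) : flowOp m t (flowOp m (-t) f) = f := by
  refine Lp.ext ?_
  filter_upwards [flowOp_coeFn m t (flowOp m (-t) f),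
    (measurePreserving_freeFlow m t).quasiMeasurePreserving.ae (flowOp_coeFn m (-t) f)] with x h1 h2
  rw [h1, h2, freeFlow_neg_freeFlow]

theorem inner_flowOp_left (m t : ℝ) (f g : PhaseL2) :
    inner ℂ (flowOp m t f) g = inner ℂ f (flowOp m (-t) g) := by
  conv_lhs => rw [← flowOp_flowOp_neg m t g]
  exact (flowOp m t).inner_map_map f _

theorem continuous_flowOp (m : ℝ) (f : PhaseL2) : Continuous fun t => flowOp m t f := by
  let F : ℝ → C(ℝ × ℝ, ℝ × ℝ) := fun t => ⟨freeFlow m t, continuous_freeFlow m t⟩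
  have hF : Continuous F := ContinuousMap.continuous_of_continuous_uncurry _
    (continuous_freeFlow_uncurry m)
  have hmp : ∀ t, MeasurePreserving (F t) (volume : Measure (ℝ × ℝ)) volume :=
    measurePreserving_freeFlow m
  exact Continuous.compMeasurePreservingLp (f := fun _ => f) continuous_const hF hmp (by norm_num)

theorem integral_flowOp_mul (m t : ℝ) (f : PhaseL2) (φ : ℝ × ℝ → ℂ) :
    ∫ x, flowOp m t f x * φ x = ∫ x, f x * φ (freeFlow m (-t) x) := by
  have e : ∫ x, flowOp m t f x * φ x =
      ∫ x, (fun y => f y * φ (freeFlow m (-t) y)) (freeFlow m t x) := by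
    refine integral_congr_ae ?_
    filter_upwards [flowOp_coeFn m t f] with x hx
    rw [hx, freeFlow_neg_freeFlow]
  rw [e]
  refine (measurePreserving_freeFlow m t).integral_comp ?_
    (fun y => f y * φ (freeFlow m (-t) y))
  refine MeasurableEmbedding.of_measurable_inverse (g := freeFlow m (-t))
    (continuous_freeFlow m t).measurable ?_ (continuous_freeFlow m (-t)).measurable
    (freeFlow_neg_freeFlow m t)
  rw [Set.range_eq_univ.2 fun x => ⟨_, freeFlow_freeFlow_neg m t x⟩]
  exact MeasurableSet.univ

theorem hasCompactSupport_comp_freeFlow (m t : ℝ) {φ : ℝ × ℝ → ℂ} (hc : HasCompactSupport φ) :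
    HasCompactSupport fun x => φ (freeFlow m t x) := by
  refine HasCompactSupport.intro (hc.isCompact.image (continuous_freeFlow m (-t))) fun x hx => ?_
  by_contra h
  exact hx ⟨freeFlow m t x, subset_closure h, freeFlow_neg_freeFlow m t x⟩

/-- The derivative `X₀ · ∇φ` along the free field. -/
def transport (m : ℝ) (φ : ℝ × ℝ → ℂ) (x : ℝ × ℝ) : ℂ := fderiv ℝ φ x (freeField m x)

theorem contDiff_transport (m : ℝ) {φ : ℝ × ℝ → ℂ} (hφ : ContDiff ℝ ∞ φ) :
    ContDiff ℝ ∞ (transport m φ) := by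
  have h1 : ContDiff ℝ ∞ (fderiv ℝ φ) := hφ.fderiv_right (by simp)
  have h2 : ContDiff ℝ ∞ (freeField m) := by unfold freeField; fun_prop
  exact h1.clm_apply h2

theorem hasCompactSupport_transport (m : ℝ) {φ : ℝ × ℝ → ℂ} (hc : HasCompactSupport φ) :
    HasCompactSupport (transport m φ) :=
  (hc.fderiv ℝ).mono fun x hx => by
    contrapose! hx
    simp only [Function.mem_support, ne_eq, not_not] at hx ⊢
    simp [transport, hx]

theorem hasDerivAt_comp_freeFlow (m t : ℝ) {φ : ℝ × ℝ → ℂ} (hφ : ContDiff ℝ ∞ φ) (x : ℝ × ℝ) :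
    HasDerivAt (fun t => φ (freeFlow m t x)) (transport m φ (freeFlow m t x)) t := by
  have h1 : HasFDerivAt φ (fderiv ℝ φ (freeFlow m t x)) (freeFlow m t x) :=
    (hφ.differentiable (by simp) _).hasFDerivAt
  exact h1.comp_hasDerivAt t (hasDerivAt_freeFlow m t x)

theorem transport_comp_freeFlow (m t : ℝ) {φ : ℝ × ℝ → ℂ} (hφ : ContDiff ℝ ∞ φ) (x : ℝ × ℝ) :
    transport m (fun x => φ (freeFlow m t x)) x = transport m φ (freeFlow m t x) := by
  have h1 := hasDerivAt_comp_freeFlow m 0 (hφ.comp (contDiff_freeFlow m t)) x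
  have h2 := hasDerivAt_comp_freeFlow m (0 + t) hφ x
  have h3 := h2.comp_add_const 0 t
  rw [freeFlow_zero, zero_add] at *
  refine h1.unique ?_
  convert h3 using 2 with s
  simp [freeFlow_freeFlow, add_comm]

theorem exists_integrable_bound_mul_comp_freeFlow (m t : ℝ) (f : PhaseL2) {ψ : ℝ × ℝ → ℂ}
    (hψ : Continuous ψ) (hc : HasCompactSupport ψ) :
    ∃ B : ℝ × ℝ → ℝ, Integrable B ∧
      ∀ x, ∀ s ∈ Set.Ioo (t - 1) (t + 1), ‖f x * ψ (freeFlow m s x)‖ ≤ B x := by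
  obtain ⟨C, hC⟩ := hc.exists_bound_of_continuous hψ
  let K : Set (ℝ × ℝ) := (fun y : ℝ × (ℝ × ℝ) => freeFlow m y.1 y.2) ''
    (Set.Icc (-(t + 1)) (-(t - 1)) ×ˢ tsupport ψ)
  have hK : IsCompact K :=
    (isCompact_Icc.prod hc.isCompact).image (continuous_freeFlow_uncurry m)
  have hfK : IntegrableOn (f : ℝ × ℝ → ℂ) K :=
    ((Lp.memLp f).locallyIntegrable (by norm_num)).integrableOn_isCompact hK
  refine ⟨K.indicator fun x => ‖f x‖ * C,
    (integrable_indicator_iff hK.measurableSet).2 (hfK.norm.mul_const C), fun x s hs => ?_⟩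
  by_cases hx : ψ (freeFlow m s x) = 0
  · rw [hx, mul_zero, norm_zero]
    exact Set.indicator_nonneg
      (fun y _ => mul_nonneg (norm_nonneg _) ((norm_nonneg _).trans (hC y))) x
  · have hxK : x ∈ K := ⟨(-s, freeFlow m s x), ⟨⟨by linarith [hs.2], by linarith [hs.1]⟩,
      subset_closure hx⟩, freeFlow_neg_freeFlow m s x⟩
    rw [Set.indicator_of_mem hxK, norm_mul]
    gcongr
    exact hC _

theorem hasDerivAt_integral_mul_comp_freeFlow (m t : ℝ) (f : PhaseL2) {φ : ℝ × ℝ → ℂ}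
    (hφ : ContDiff ℝ ∞ φ) (hc : HasCompactSupport φ) :
    HasDerivAt (fun t => ∫ x, f x * φ (freeFlow m t x))
      (∫ x, f x * transport m φ (freeFlow m t x)) t := by
  have hφ' := (contDiff_transport m hφ).continuous
  have hfm : AEStronglyMeasurable (f : ℝ × ℝ → ℂ) volume := Lp.aestronglyMeasurable f
  obtain ⟨B, hB, hle⟩ :=
    exists_integrable_bound_mul_comp_freeFlow m t f hφ' (hasCompactSupport_transport m hc)
  exact (hasDerivAt_integral_of_dominated_loc_of_deriv_le
    (F' := fun t x => f x * transport m φ (freeFlow m t x))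
    (Ioo_mem_nhds (sub_one_lt t) (lt_add_one t))
    (Filter.Eventually.of_forall fun s =>
      hfm.mul (hφ.continuous.comp (continuous_freeFlow m s)).aestronglyMeasurable)
    (integrable_mul_of_hasCompactSupport f (hφ.continuous.comp (continuous_freeFlow m t))
      (hasCompactSupport_comp_freeFlow m t hc))
    (hfm.mul (hφ'.comp (continuous_freeFlow m t)).aestronglyMeasurable)
    (Filter.Eventually.of_forall hle) hB
    (Filter.Eventually.of_forall fun x s _ =>
      (hasDerivAt_comp_freeFlow m s hφ x).const_mul (f x))).2

theorem HasWeakTransport.hasDerivAt {m : ℝ} {f h : PhaseL2} (H : HasWeakTransport m f h) (t : ℝ)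
    {φ : ℝ × ℝ → ℂ} (hφ : ContDiff ℝ ∞ φ) (hc : HasCompactSupport φ) :
    HasDerivAt (fun t => ∫ x, f x * φ (freeFlow m t x))
      (-∫ x, h x * φ (freeFlow m t x)) t := by
  rw [← H (fun x => φ (freeFlow m t x)) (hφ.comp (contDiff_freeFlow m t))
    (hasCompactSupport_comp_freeFlow m t hc)]
  convert hasDerivAt_integral_mul_comp_freeFlow m t f hφ hc using 4 with x
  exact transport_comp_freeFlow m t hφ x

/-- The class in `L²` of a continuous function with compact support. -/
def testLp {φ : ℝ × ℝ → ℂ} (hφ : Continuous φ) (hc : HasCompactSupport φ) : PhaseL2 :=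
  (hφ.memLp_of_hasCompactSupport hc).toLp φ

theorem testLp_coeFn {φ : ℝ × ℝ → ℂ} (hφ : Continuous φ) (hc : HasCompactSupport φ) :
    testLp hφ hc =ᵐ[volume] φ :=
  MemLp.coeFn_toLp _

theorem hasWeakTransport_testLp (m : ℝ) {φ : ℝ × ℝ → ℂ} (hφ : ContDiff ℝ ∞ φ)
    (hc : HasCompactSupport φ) :
    HasWeakTransport m (testLp hφ.continuous hc)
      (testLp (contDiff_transport m hφ).continuous (hasCompactSupport_transport m hc)) := by
  intro ψ hψ hcψ
  have h1 := hasDerivAt_integral_mul_comp_freeFlow m 0 (testLp hφ.continuous hc) hψ hcψ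
  have h2 := (hasDerivAt_integral_mul_comp_freeFlow m (-0) (testLp hψ.continuous hcψ)
    hφ hc).scomp 0 (hasDerivAt_neg 0)
  have e : (fun t => ∫ x, testLp hψ.continuous hcψ x * φ (freeFlow m t x)) ∘ Neg.neg =
      fun t => ∫ x, testLp hφ.continuous hc x * ψ (freeFlow m t x) := by
    funext t
    rw [Function.comp_apply, ← integral_flowOp_mul]
    refine integral_congr_ae ?_
    filter_upwards [flowOp_coeFn m t (testLp hψ.continuous hcψ), testLp_coeFn hφ.continuous hc,
      (measurePreserving_freeFlow m t).quasiMeasurePreserving.ae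
        (testLp_coeFn hψ.continuous hcψ)] with x a b c
    rw [a, b, c, mul_comm]
  rw [e] at h2
  have h3 := h1.unique h2
  rw [neg_zero, neg_smul, one_smul] at h3
  simp only [freeFlow_zero] at h3
  refine h3.trans (congrArg _ (integral_congr_ae ?_))
  filter_upwards [testLp_coeFn hψ.continuous hcψ, testLp_coeFn
    (contDiff_transport m hφ).continuous (hasCompactSupport_transport m hc)] with x a b
  rw [a, b, mul_comm]

end Flow

section FreeOperator

theorem HasWeakTransport.mem_domain {m : ℝ} {f h : PhaseL2} (H : HasWeakTransport m f h) :
    ∃ hf : f ∈ (freeOp m).domain, freeOp m ⟨f, hf⟩ = -I • h := by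
  have h1 : (f, -I • h) ∈ (freeOp m).graph := by
    rw [freeOp_graph]
    exact ⟨h, H, rfl⟩
  obtain ⟨y, hy1, hy2⟩ := (LinearPMap.mem_graph_iff _).1 h1
  simp only at hy1 hy2
  subst hy1
  exact ⟨y.2, hy2⟩

theorem hasWeakTransport_freeOp {m : ℝ} (u : (freeOp m).domain) :
    HasWeakTransport m (u : PhaseL2) (I • freeOp m u) := by
  have h1 : ((u : PhaseL2), freeOp m u) ∈ (freeOp m).graph := LinearPMap.mem_graph _ u
  rw [freeOp_graph] at h1
  obtain ⟨h, H, e⟩ := h1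
  simp only at H e
  rw [e, smul_smul]
  simpa using H

end FreeOperator

section TestPairing

/-- The continuous functional `f ↦ ∫ f φ`, for `φ` continuous with compact support. -/
def testPairing {φ : ℝ × ℝ → ℂ} (hφ : Continuous φ) (hc : HasCompactSupport φ) :
    PhaseL2 →L[ℂ] ℂ :=
  innerSL ℂ (testLp (φ := fun x => conj (φ x)) (by fun_prop) (hc.comp_left (map_zero _)))

theorem testPairing_apply {φ : ℝ × ℝ → ℂ} (hφ : Continuous φ) (hc : HasCompactSupport φ)
    (f : PhaseL2) : testPairing hφ hc f = ∫ x, f x * φ x := by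
  rw [testPairing, innerSL_apply_apply, L2.inner_def]
  refine integral_congr_ae ?_
  filter_upwards [testLp_coeFn (φ := fun x => conj (φ x)) (by fun_prop)
    (hc.comp_left (map_zero _))] with x hx
  rw [hx]
  simp

theorem eq_zero_of_testPairing {f : PhaseL2} (h : ∀ (φ : ℝ × ℝ → ℂ) (hφ : ContDiff ℝ ∞ φ)
    (hc : HasCompactSupport φ), testPairing hφ.continuous hc f = 0) : f = 0 := by
  refine HasWeakTransport.eq_zero (m := 1) fun φ hφ hc => ?_
  rw [← testPairing_apply hφ.continuous hc f, h φ hφ hc, neg_zero]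
  refine integral_eq_zero_of_ae ?_
  filter_upwards [Lp.coeFn_zero ℂ 2 (volume : Measure (ℝ × ℝ))] with x hx
  rw [hx]
  simp

theorem testPairing_flowOp_neg (m t : ℝ) {φ : ℝ × ℝ → ℂ} (hφ : Continuous φ)
    (hc : HasCompactSupport φ) (f : PhaseL2) :
    testPairing hφ hc (flowOp m (-t) f) = ∫ x, f x * φ (freeFlow m t x) := by
  rw [testPairing_apply, integral_flowOp_mul, neg_neg]

end TestPairing

section FreeResolvent

theorem aestronglyMeasurable_flowOp_neg (m : ℝ) (v : PhaseL2) :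
    AEStronglyMeasurable fun t => flowOp m (-t) v :=
  ((continuous_flowOp m v).comp continuous_neg).aestronglyMeasurable

/-- The operator `∫ k_z(t) (f ∘ Φ_{-t}) dt`, with `k_z` the resolvent kernel: the free resolvent in
terms of the free flow. -/
def flowResolvent (m : ℝ) {z : ℂ} (hz : z.im ≠ 0) : PhaseL2 →L[ℂ] PhaseL2 :=
  isometryIntegral (aestronglyMeasurable_flowOp_neg m) (integrable_resolventKernel hz)

theorem adjoint_flowResolvent (m : ℝ) {z : ℂ} (hz : z.im ≠ 0) :
    ContinuousLinearMap.adjoint (flowResolvent m hz) = flowResolvent m (conj_im_ne_zero hz) := by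
  rw [flowResolvent, adjoint_isometryIntegral _
    (fun v => (continuous_flowOp m v).aestronglyMeasurable) _
    (integrable_resolventKernel (conj_im_ne_zero hz)).comp_neg
    (fun t f g => by rw [inner_flowOp_left, neg_neg]) (conj_resolventKernel z)]
  ext1 v
  rw [flowResolvent, isometryIntegral_apply, isometryIntegral_apply, ← integral_neg_eq_self]
  simp only [neg_neg]

theorem hasWeakTransport_flowResolvent (m : ℝ) {z : ℂ} (hz : z.im ≠ 0) (v : PhaseL2) :
    HasWeakTransport m (flowResolvent m hz v) (I • (v + z • flowResolvent m hz v)) := by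
  intro φ hφ hc
  have h := map_isometryIntegral_resolventKernel_of_hasDerivAt hz
    (aestronglyMeasurable_flowOp_neg m) (f := v) (g := v) (ℓ := testPairing hφ.continuous hc)
    (ℓ' := testPairing (contDiff_transport m hφ).continuous (hasCompactSupport_transport m hc))
    (fun t => by
      simp only [testPairing_flowOp_neg]
      exact hasDerivAt_integral_mul_comp_freeFlow m t v hφ hc)
  rw [testPairing_apply, flowOp_zero] at h
  refine h.trans ?_
  rw [← testPairing_apply hφ.continuous hc, map_smul, map_add, map_smul, smul_eq_mul,
    smul_eq_mul, neg_mul]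
  rfl

theorem flowResolvent_of_hasWeakTransport {m : ℝ} {z : ℂ} (hz : z.im ≠ 0) {f h : PhaseL2}
    (H : HasWeakTransport m f h) :
    flowResolvent m hz h = I • (f + z • flowResolvent m hz f) := by
  rw [← sub_eq_zero]
  refine eq_zero_of_testPairing fun φ hφ hc => ?_
  have key := map_isometryIntegral_resolventKernel_of_hasDerivAt hz
    (aestronglyMeasurable_flowOp_neg m) (ℓ := testPairing hφ.continuous hc)
    (ℓ' := -testPairing hφ.continuous hc) (f := f) (g := h)
    (fun t => by
      simp only [neg_apply, testPairing_flowOp_neg]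
      exact H.hasDerivAt t hφ hc)
  rw [neg_apply, flowOp_zero] at key
  rw [flowResolvent, map_sub, map_smul, map_add, map_smul, smul_eq_mul, smul_eq_mul]
  linear_combination -key

theorem isResolventAt_flowResolvent (m : ℝ) {z : ℂ} (hz : z.im ≠ 0) :
    IsResolventAt (freeOp m) z (flowResolvent m hz) := by
  refine ⟨fun v => ?_, fun u => ?_⟩
  · obtain ⟨hf, e⟩ := (hasWeakTransport_flowResolvent m hz v).mem_domain
    refine ⟨hf, ?_⟩
    rw [e, smul_smul, neg_mul, I_mul_I, neg_neg, one_smul, add_sub_cancel_right]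
  · have key := flowResolvent_of_hasWeakTransport hz (hasWeakTransport_freeOp u)
    rw [map_smul, smul_right_inj I_ne_zero] at key
    rw [map_sub, map_smul, key, add_sub_cancel_right]

theorem isResolventAt_freeResolvent (m : ℝ) {z : ℂ} (hz : z.im ≠ 0) :
    IsResolventAt (freeOp m) z (freeResolvent m z) := by
  have h : ∃ R, IsResolvent (freeOp m) z R := ⟨_, isResolventAt_flowResolvent m hz⟩
  rw [freeResolvent, dif_pos h]
  exact h.choose_spec

theorem freeResolvent_eq_flowResolvent (m : ℝ) {z : ℂ} (hz : z.im ≠ 0) :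
    freeResolvent m z = flowResolvent m hz :=
  (isResolventAt_freeResolvent m hz).unique (isResolventAt_flowResolvent m hz)

theorem adjoint_freeResolvent (m : ℝ) {z : ℂ} (hz : z.im ≠ 0) :
    ContinuousLinearMap.adjoint (freeResolvent m z) = freeResolvent m (conj z) := by
  rw [freeResolvent_eq_flowResolvent m hz, adjoint_flowResolvent,
    freeResolvent_eq_flowResolvent m (conj_im_ne_zero hz)]

theorem isSelfAdjoint_freeOp (m : ℝ) : IsSelfAdjoint (freeOp m) := by
  have hI : I.im ≠ 0 := by simp
  refine (isResolventAt_freeResolvent m hI).isSelfAdjoint ?_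
  rw [adjoint_freeResolvent m hI]
  exact isResolventAt_freeResolvent m (conj_im_ne_zero hI)

end FreeResolvent

section AbsMeasure

theorem ae_ne_zero_real : ∀ᵐ p : ℝ, p ≠ 0 := by simp [ae_iff, measure_singleton]

theorem ae_absMeasure_iff (n : ℤ) {P : ℝ → Prop} :
    (∀ᵐ p ∂absMeasure n, P p) ↔ ∀ᵐ p : ℝ, P p := by
  rw [absMeasure, ae_withDensity_iff (by fun_prop)]
  constructor
  · intro h
    filter_upwards [h, ae_ne_zero_real] with p hp h0
    refine hp ?_
    have : 0 < |p| ^ n := zpow_pos (abs_pos.2 h0) n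
    simpa using this
  · intro h
    filter_upwards [h] with p hp _ using hp

instance sigmaFinite_absMeasure (n : ℤ) : SigmaFinite (absMeasure n) := by
  unfold absMeasure
  exact SigmaFinite.withDensity_ofReal _

theorem integral_absMeasure (n : ℤ) (f : ℝ → ℂ) :
    ∫ p, f p ∂absMeasure n = ∫ p : ℝ, ((|p| ^ n : ℝ) : ℂ) * f p := by
  rw [absMeasure, integral_withDensity_eq_integral_toReal_smul (by fun_prop)
    (Filter.Eventually.of_forall fun p => ENNReal.ofReal_lt_top)]
  refine integral_congr_ae (Filter.Eventually.of_forall fun p => ?_)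
  simp only
  rw [ENNReal.toReal_ofReal (by positivity), real_smul]

theorem setIntegral_absMeasure (n : ℤ) (f : ℝ → ℂ) {s : Set ℝ} (hs : MeasurableSet s) :
    ∫ p in s, f p ∂absMeasure n = ∫ p in s, ((|p| ^ n : ℝ) : ℂ) * f p := by
  rw [absMeasure, setIntegral_withDensity_eq_setIntegral_toReal_smul (by fun_prop)
    (Filter.Eventually.of_forall fun p => ENNReal.ofReal_lt_top) _ hs]
  refine integral_congr_ae (Filter.Eventually.of_forall fun p => ?_)
  simp only
  rw [ENNReal.toReal_ofReal (by positivity), real_smul]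

theorem integrableOn_absMeasure_iff (n : ℤ) (f : ℝ → ℂ) {s : Set ℝ} (hs : MeasurableSet s) :
    IntegrableOn f s (absMeasure n) ↔ IntegrableOn (fun p : ℝ => ((|p| ^ n : ℝ) : ℂ) * f p) s := by
  rw [IntegrableOn, absMeasure, restrict_withDensity hs,
    integrable_withDensity_iff_integrable_smul' (by fun_prop)
    (Filter.Eventually.of_forall fun p => ENNReal.ofReal_lt_top)]
  refine integrable_congr (Filter.Eventually.of_forall fun p => ?_)
  simp only
  rw [ENNReal.toReal_ofReal (by positivity), real_smul]

end AbsMeasure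

theorem integral_indicator_const_eq_indicator_integral {α β : Type*} [MeasurableSpace α]
    (ν : Measure α) (f : α × β → ℂ) (s : Set β) (p : β) :
    ∫ q, s.indicator (fun _ => f (q, p)) p ∂ν = s.indicator (fun p => ∫ q, f (q, p) ∂ν) p := by
  by_cases hp : p ∈ s <;> simp [hp]

section AdjointWeightedComposition

variable {α β : Type*} [MeasurableSpace α] [MeasurableSpace β] {ν : Measure α} {ν' μ : Measure β}
  {k : α × β → ℂ} {C : ℝ≥0}

theorem inner_weightedComp_snd_indicatorConstLp_ae
    (h : WeightBound μ (ν.prod ν') Prod.snd k C) (hk : Measurable k)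
    (f : Lp ℂ 2 (ν.prod ν')) {s : Set β} (hs : MeasurableSet s) (hμs : μ s ≠ ⊤) :
    (fun x => inner ℂ (weightedComp h measurable_snd hk (indicatorConstLp 2 hs hμs 1) x) (f x))
      =ᵐ[ν.prod ν'] fun x => s.indicator (fun _ => conj (k x) * f x) x.2 := by
  filter_upwards [weightedComp_coeFn h measurable_snd hk (indicatorConstLp 2 hs hμs 1),
    h.ae_eq measurable_snd hk (indicatorConstLp_coeFn (hs := hs) (hμs := hμs) (c := 1))]
    with x h1 h2
  rw [h1, h2]
  by_cases hx : x.2 ∈ s <;> simp [hx, mul_comm]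

theorem integrable_indicator_conj_mul_of_weightBound
    (h : WeightBound μ (ν.prod ν') Prod.snd k C) (hk : Measurable k)
    (f : Lp ℂ 2 (ν.prod ν')) {s : Set β} (hs : MeasurableSet s) (hμs : μ s ≠ ⊤) :
    Integrable (fun x => s.indicator (fun _ => conj (k x) * f x) x.2) (ν.prod ν') :=
  (L2.integrable_inner _ f).congr (inner_weightedComp_snd_indicatorConstLp_ae h hk f hs hμs)

variable [SFinite ν] [SFinite ν']

theorem integrableOn_integral_conj_mul_of_weightBound
    (h : WeightBound μ (ν.prod ν') Prod.snd k C) (hk : Measurable k)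
    (f : Lp ℂ 2 (ν.prod ν')) {s : Set β} (hs : MeasurableSet s) (hμs : μ s ≠ ⊤) :
    IntegrableOn (fun p => ∫ q, conj (k (q, p)) * f (q, p) ∂ν) s ν' := by
  have hint := (integrable_indicator_conj_mul_of_weightBound h hk f hs hμs).integral_prod_right
  simp only [integral_indicator_const_eq_indicator_integral ν (fun x => conj (k x) * f x)] at hint
  exact (integrable_indicator_iff hs).1 hint

theorem setIntegral_adjoint_weightedComp_snd
    (h : WeightBound μ (ν.prod ν') Prod.snd k C) (hk : Measurable k)
    (f : Lp ℂ 2 (ν.prod ν')) {s : Set β} (hs : MeasurableSet s) (hμs : μ s ≠ ⊤) :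
    ∫ p in s, ContinuousLinearMap.adjoint (weightedComp h measurable_snd hk) f p ∂μ =
      ∫ p in s, ∫ q, conj (k (q, p)) * f (q, p) ∂ν ∂ν' := by
  rw [← L2.inner_indicatorConstLp_one (𝕜 := ℂ) hs hμs, ContinuousLinearMap.adjoint_inner_right,
    L2.inner_def, integral_congr_ae (inner_weightedComp_snd_indicatorConstLp_ae h hk f hs hμs),
    integral_prod_symm _ (integrable_indicator_conj_mul_of_weightBound h hk f hs hμs),
    ← integral_indicator hs]
  simp only [integral_indicator_const_eq_indicator_integral ν (fun x => conj (k x) * f x)]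

end AdjointWeightedComposition

section DualAdjoint

theorem integral_conj_mul_dualAdjoint (T : LineL2 (-1) →L[ℂ] PhaseL2) (φ : LineL2 (-1))
    (f : PhaseL2) : ∫ p : ℝ, conj (φ p) * dualAdjoint T f p = inner ℂ (T φ) f := by
  rw [← ContinuousLinearMap.adjoint_inner_right, L2.inner_def, integral_absMeasure]
  refine integral_congr_ae ?_
  filter_upwards [(ae_absMeasure_iff 1).1 (weightedComp_coeFn weightBound_invAbs measurable_id
    measurable_invAbs (ContinuousLinearMap.adjoint T f))] with p hp
  rw [dualAdjoint, ContinuousLinearMap.comp_apply, hp]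
  simp only [Int.reduceNeg, ofReal_inv, id_eq, zpow_neg, zpow_ofNat, pow_one, RCLike.inner_apply]
  ring

theorem opG_coeFn {m : ℝ} (hm : 0 < m) {z : ℂ} (hz : z.im ≠ 0) (φ : LineL2 (-1)) :
    opG hm hz φ =ᵐ[volume] fun x => green m z x * φ x.2 :=
  weightedComp_coeFn _ _ _ _

theorem adjoint_opG_coeFn {m : ℝ} (hm : 0 < m) {z : ℂ} (hz : z.im ≠ 0) (f : PhaseL2) :
    ContinuousLinearMap.adjoint (opG hm hz) f =ᵐ[absMeasure (-1)]
      fun p => |p| * ∫ q, conj (green m z (q, p)) * f (q, p) := by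
  have hcancel : ∀ᵐ p : ℝ, ((|p| ^ (-1 : ℤ) : ℝ) : ℂ) * (|p| *
      ∫ q, conj (green m z (q, p)) * f (q, p)) = ∫ q, conj (green m z (q, p)) * f (q, p) := by
    filter_upwards [ae_ne_zero_real] with p hp
    have : ((|p| : ℝ) : ℂ) ≠ 0 := by simpa using hp
    rw [zpow_neg_one, ofReal_inv, inv_mul_cancel_left₀ this]
  refine ae_eq_of_forall_setIntegral_eq_of_sigmaFinite (fun s _ hμ => ?_) (fun s hs hμ => ?_)
    fun s hs hμ => ?_
  · exact integrableOn_Lp_of_measure_ne_top _ (by norm_num) hμ.ne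
  · rw [integrableOn_absMeasure_iff _ _ hs]
    exact (integrableOn_integral_conj_mul_of_weightBound (weightBound_green hm hz)
      (measurable_green m z) f hs hμ.ne).congr
        (ae_restrict_of_ae (hcancel.mono fun p hp => hp.symm))
  · rw [opG, setIntegral_adjoint_weightedComp_snd (weightBound_green hm hz) (measurable_green m z)
      f hs hμ.ne, setIntegral_absMeasure _ _ hs]
    exact integral_congr_ae (ae_restrict_of_ae (hcancel.mono fun p hp => hp.symm))

theorem dualAdjoint_opG_coeFn {m : ℝ} (hm : 0 < m) {z : ℂ} (hz : z.im ≠ 0) (f : PhaseL2) :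
    dualAdjoint (opG hm hz) f =ᵐ[absMeasure 1]
      fun p => ∫ q, conj (green m z (q, p)) * f (q, p) := by
  have h := (ae_absMeasure_iff 1).2 ((ae_absMeasure_iff (-1)).1 (adjoint_opG_coeFn hm hz f))
  filter_upwards [weightedComp_coeFn weightBound_invAbs measurable_id
    measurable_invAbs (ContinuousLinearMap.adjoint (opG hm hz) f), h,
    (ae_absMeasure_iff 1).2 ae_ne_zero_real] with p h1 h2 h3
  have : ((|p| : ℝ) : ℂ) ≠ 0 := by simpa using h3
  rw [dualAdjoint, ContinuousLinearMap.comp_apply, h1, id, h2]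
  push_cast
  rw [inv_mul_cancel_left₀ this]

end DualAdjoint

section GreenFunction

theorem green_apply (m : ℝ) (z : ℂ) (q p : ℝ) :
    green m z (q, p) = if 0 < q * p * z.im then
      imSign z * (I * m / (|p| : ℝ)) * exp (I * m * z * q / p) else 0 := by
  simp only [green, imSign, ite_mul, one_mul, zero_mul]

theorem conj_green (m : ℝ) (z : ℂ) (q p : ℝ) :
    conj (green m z (q, p)) = green m (conj z) (-q, p) := by
  have hcond : (0 < -q * p * (conj z).im) = (0 < q * p * z.im) := by
    rw [conj_im]; congr 1; ring
  have hexp : conj (I * m * z * q / p) = I * m * conj z * (-q : ℝ) / p := by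
    simp only [map_mul, map_div₀, conj_I, conj_ofReal, ofReal_neg]; ring
  simp only [green_apply, hcond, imSign_conj, conj_imSign, map_mul, map_div₀, conj_I,
    conj_ofReal, ← exp_conj, hexp, apply_ite (starRingEnd ℂ), map_zero]
  split_ifs <;> ring

theorem green_mul_right {m : ℝ} (hm : 0 < m) (z : ℂ) {p : ℝ} (hp : p ≠ 0) (t : ℝ) :
    green m z (t * (p / m), p) = m / |p| * resolventKernel z t := by
  have hcond : 0 < t * (p / m) * p * z.im ↔ 0 < t * z.im := by
    rw [show t * (p / m) * p * z.im = p * p / m * (t * z.im) by ring]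
    exact mul_pos_iff_of_pos_left (div_pos (mul_self_pos.2 hp) hm)
  have hexp : I * m * z * (t * (p / m) : ℝ) / p = I * z * t := by
    have hpc : (p : ℂ) ≠ 0 := by exact_mod_cast hp
    have hmc : (m : ℂ) ≠ 0 := by exact_mod_cast hm.ne'
    push_cast
    field_simp
  simp only [green_apply, resolventKernel, hcond, hexp]
  split_ifs <;> ring

theorem integral_eq_smul_integral_comp_mul_div {E : Type*} [NormedAddCommGroup E]
    [NormedSpace ℝ E] {m p : ℝ} (hm : 0 < m) (hp : p ≠ 0) (f : ℝ → E) :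
    ∫ q, f q = (|p| / m) • ∫ t, f (t * (p / m)) := by
  have := abs_pos.2 hp
  rw [Measure.integral_comp_mul_right, smul_smul, abs_inv, abs_div, abs_of_pos hm,
    mul_inv_cancel₀ (by positivity), one_smul]

theorem integral_green_mul {m : ℝ} (hm : 0 < m) (z : ℂ) (w : ℝ → ℂ) (q : ℝ) {p : ℝ}
    (hp : p ≠ 0) :
    ∫ q', green m z (q - q', p) * w q' =
      ∫ t, resolventKernel z t * w (q + -t * (p / m)) := by
  have hpc : ((|p| : ℝ) : ℂ) ≠ 0 := by simpa using hp
  have hmc : (m : ℂ) ≠ 0 := by exact_mod_cast hm.ne'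
  rw [← integral_sub_left_eq_self _ volume q, integral_eq_smul_integral_comp_mul_div hm hp,
    ← integral_smul]
  refine integral_congr_ae (Filter.Eventually.of_forall fun t => ?_)
  simp only [sub_sub_cancel, green_mul_right hm z hp, real_smul, ofReal_div, neg_mul,
    ← sub_eq_add_neg]
  field_simp

theorem integral_conj_green_mul_green {m : ℝ} (hm : 0 < m) (z w : ℂ) {p : ℝ} (hp : p ≠ 0) :
    |p| * ∫ q, conj (green m (conj w) (q, p)) * green m z (q, p) =
      m * ∫ t, resolventKernel w (-t) * resolventKernel z t := by
  have hpc : ((|p| : ℝ) : ℂ) ≠ 0 := by simpa using hp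
  have hmc : (m : ℂ) ≠ 0 := by exact_mod_cast hm.ne'
  have hint : ∀ t, conj (green m (conj w) (t * (p / m), p)) * green m z (t * (p / m), p) =
      (m / |p|) ^ 2 * (resolventKernel w (-t) * resolventKernel z t) := fun t => by
    rw [conj_green, conj_conj, ← neg_mul, green_mul_right hm w hp, green_mul_right hm z hp]
    ring
  rw [integral_eq_smul_integral_comp_mul_div hm hp]
  simp only [hint]
  rw [integral_const_mul, real_smul, ofReal_div]
  field_simp

end GreenFunction

section GreenConvolution

/-- The convolution in `q` of `v` with the Green function `g_z`. -/
def greenConv (m : ℝ) (z : ℂ) (v : PhaseL2) (x : ℝ × ℝ) : ℂ :=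
  ∫ q', green m z (x.1 - q', x.2) * v (q', x.2)

theorem greenConv_eq_integral_resolventKernel {m : ℝ} (hm : 0 < m) (z : ℂ) (v : PhaseL2)
    {x : ℝ × ℝ} (hx : x.2 ≠ 0) :
    greenConv m z v x = ∫ t, resolventKernel z t * v (freeFlow m (-t) x) :=
  integral_green_mul hm z (fun q' => v (q', x.2)) x.1 hx

theorem measurePreserving_prod_freeFlow_neg (m : ℝ) :
    MeasurePreserving (fun y : ℝ × (ℝ × ℝ) => (y.1, freeFlow m (-y.1) y.2))
      ((volume : Measure ℝ).prod volume) ((volume : Measure ℝ).prod volume) := by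
  refine (MeasurePreserving.id (volume : Measure ℝ)).skew_product
    (g := fun t x => freeFlow m (-t) x) ?_
    (Filter.Eventually.of_forall fun t => (measurePreserving_freeFlow m (-t)).map_eq)
  exact ((continuous_freeFlow_uncurry m).comp
    (by fun_prop : Continuous fun y : ℝ × (ℝ × ℝ) => (-y.1, y.2))).measurable

theorem integrable_mul_comp_freeFlow_neg (m : ℝ) {k : ℝ → ℂ} (hk : Integrable k) (v : PhaseL2)
    {s : Set (ℝ × ℝ)} (hs : volume s ≠ ⊤) :
    Integrable (fun y : ℝ × (ℝ × ℝ) => k y.1 * v (freeFlow m (-y.1) y.2))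
      ((volume : Measure ℝ).prod (volume.restrict s)) := by
  have hle : (volume : Measure ℝ).prod ((volume : Measure (ℝ × ℝ)).restrict s) ≤
      (volume : Measure ℝ).prod volume := by
    rw [← Measure.restrict_univ (μ := (volume : Measure ℝ)), Measure.prod_restrict]
    simpa only [Measure.restrict_univ] using Measure.restrict_le_self
  have hΦ := measurePreserving_prod_freeFlow_neg m
  have : IsFiniteMeasure ((volume : Measure (ℝ × ℝ)).restrict s) :=
    isFiniteMeasure_restrict.2 hs
  have hsq : Integrable (fun x => ‖v x‖ ^ 2) :=
    (memLp_two_iff_integrable_sq_norm (Lp.aestronglyMeasurable v)).1 (Lp.memLp v)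
  have hksq : Integrable (fun y : ℝ × (ℝ × ℝ) => ‖k y.1‖ * ‖v (freeFlow m (-y.1) y.2)‖ ^ 2)
      ((volume : Measure ℝ).prod (volume.restrict s)) :=
    (hΦ.integrable_comp_of_integrable (hk.norm.mul_prod hsq)).mono_measure hle
  have hk1 : Integrable (fun y : ℝ × (ℝ × ℝ) => ‖k y.1‖)
      ((volume : Measure ℝ).prod (volume.restrict s)) := hk.norm.comp_fst _
  refine (hk1.add hksq).mono' ?_ (Filter.Eventually.of_forall fun y => ?_)
  · exact (hk.aestronglyMeasurable.comp_fst.mul ((Lp.aestronglyMeasurable v).comp_snd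
      |>.comp_measurePreserving hΦ |>.mono_measure hle))
  · rw [norm_mul, Pi.add_apply, ← mul_one_add]
    gcongr
    nlinarith [sq_nonneg (‖v (freeFlow m (-y.1) y.2)‖ - 1), norm_nonneg (v (freeFlow m (-y.1) y.2))]

theorem flowResolvent_coeFn {m : ℝ} (hm : 0 < m) {z : ℂ} (hz : z.im ≠ 0) (v : PhaseL2) :
    flowResolvent m hz v =ᵐ[volume] greenConv m z v := by
  suffices h : flowResolvent m hz v =ᵐ[volume]
      fun x => ∫ t, resolventKernel z t * v (freeFlow m (-t) x) by
    filter_upwards [h, Measure.quasiMeasurePreserving_snd.ae ae_ne_zero_real] with x hx hp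
    rw [hx, greenConv_eq_integral_resolventKernel hm z v hp]
  have hint := fun {s : Set (ℝ × ℝ)} (hs : volume s ≠ ⊤) =>
    integrable_mul_comp_freeFlow_neg m (integrable_resolventKernel hz) v hs
  refine ae_eq_of_forall_setIntegral_eq_of_sigmaFinite (fun s _ hμ => ?_) (fun s _ hμ => ?_)
    fun s hs hμ => ?_
  · exact integrableOn_Lp_of_measure_ne_top _ (by norm_num) hμ.ne
  · exact (hint hμ.ne).integral_prod_right
  · rw [← integral_integral_swap (hint hμ.ne), ← L2.inner_indicatorConstLp_one (𝕜 := ℂ) hs hμ.ne,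
      ← innerSL_apply_apply ℂ, flowResolvent, map_isometryIntegral]
    refine integral_congr_ae (Filter.Eventually.of_forall fun t => ?_)
    simp only [innerSL_apply_apply, L2.inner_indicatorConstLp_one]
    rw [integral_const_mul]
    congr 1
    exact integral_congr_ae (ae_restrict_of_ae (flowOp_coeFn m (-t) v))

theorem memLp_green {m : ℝ} (hm : 0 < m) {z : ℂ} (hz : z.im ≠ 0) {p : ℝ} (hp : p ≠ 0) :
    MemLp (fun q => green m z (q, p)) 2 volume := by
  have hg : Measurable fun q => green m z (q, p) := (measurable_green m z).comp (by fun_prop)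
  have : 0 < |z.im| := abs_pos.mpr hz
  have : 0 < |p| := abs_pos.mpr hp
  rw [memLp_two_iff_integrable_sq_norm hg.aestronglyMeasurable]
  refine ⟨(hg.norm.pow_const 2).aestronglyMeasurable, ?_⟩
  rw [hasFiniteIntegral_iff_enorm]
  calc ∫⁻ q, ‖‖green m z (q, p)‖ ^ 2‖ₑ
      ≤ ∫⁻ q, ENNReal.ofReal (m ^ 2 / p ^ 2) *
        ENNReal.ofReal (Real.exp (-(2 * m * |z.im| / |p|) * |q|)) := by
        refine lintegral_mono fun q => ?_
        simp only [enorm_pow, enorm_norm]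
        exact enorm_green_le hm q p hp
    _ < ⊤ := by
        rw [lintegral_const_mul _ (by fun_prop), lintegral_exp_neg_mul_abs (by positivity)]
        exact ENNReal.mul_lt_top ENNReal.ofReal_lt_top ENNReal.ofReal_lt_top

theorem continuous_convolution_of_memLp_two {g w : ℝ → ℂ} (hg : MemLp g 2 volume)
    (hw : MemLp w 2 volume) : Continuous fun q => ∫ q', g (q - q') * w q' := by
  have hgc : MemLp (fun q => conj (g q)) 2 volume := hg.star
  let F : ℝ → C(ℝ, ℝ) := fun q => ⟨fun q' => q - q', by fun_prop⟩
  have hF : Continuous F := ContinuousMap.continuous_of_continuous_uncurry _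
    (by unfold F Function.uncurry; simp only [ContinuousMap.coe_mk]; fun_prop)
  have hmp : ∀ q, MeasurePreserving (F q) (volume : Measure ℝ) volume := fun q =>
    Measure.measurePreserving_sub_left volume q
  have hc := Continuous.compMeasurePreservingLp (f := fun _ => hgc.toLp _) continuous_const hF hmp
    (by norm_num)
  refine (hc.inner (𝕜 := ℂ) (continuous_const (y := hw.toLp w))).congr fun q => ?_
  rw [L2.inner_def]
  refine integral_congr_ae ?_
  filter_upwards [Lp.coeFn_compMeasurePreserving (hgc.toLp _) (hmp q), hw.coeFn_toLp,
    (hmp q).quasiMeasurePreserving.ae hgc.coeFn_toLp] with q' h1 h2 h3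
  rw [h1, h2, Function.comp_apply, h3]
  simp [F, mul_comm]

theorem continuous_greenConv {m : ℝ} (hm : 0 < m) {z : ℂ} (hz : z.im ≠ 0) (v : PhaseL2) :
    ∀ᵐ p : ℝ, Continuous fun q => greenConv m z v (q, p) := by
  have hsq : Integrable (fun x => ‖v x‖ ^ 2) ((volume : Measure ℝ).prod volume) :=
    (memLp_two_iff_integrable_sq_norm (Lp.aestronglyMeasurable v)).1 (Lp.memLp v)
  filter_upwards [hsq.prod_left_ae, ae_ne_zero_real] with p h1 hp
  refine continuous_convolution_of_memLp_two (memLp_green hm hz hp)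
    (w := fun q' => v (q', p)) ?_
  refine (memLp_two_iff_integrable_sq_norm ?_).2 h1
  exact ((Lp.stronglyMeasurable v).measurable.comp (by fun_prop)).aestronglyMeasurable

end GreenConvolution

section Trace

theorem isTrace_dualAdjoint {m : ℝ} (hm : 0 < m) {z : ℂ} (hz : z.im ≠ 0)
    (u : (freeOp m).domain) :
    IsTrace u (dualAdjoint (opG hm hz) (freeOp m u - conj z • (u : PhaseL2))) := by
  refine ⟨greenConv m (conj z) (freeOp m u - conj z • (u : PhaseL2)), ?_,
    continuous_greenConv hm (conj_im_ne_zero hz) _, ?_⟩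
  · have h := flowResolvent_coeFn hm (conj_im_ne_zero hz) (freeOp m u - conj z • (u : PhaseL2))
    rwa [(isResolventAt_flowResolvent m (conj_im_ne_zero hz)).2 u] at h
  · refine (dualAdjoint_opG_coeFn hm hz _).trans (Filter.Eventually.of_forall fun p => ?_)
    simp only [greenConv, zero_sub, conj_green]

theorem isTrace_traceMap {m : ℝ} (hm : 0 < m) (u : (freeOp m).domain) :
    IsTrace u (traceMap m u) := by
  have hI : I.im ≠ 0 := by simp
  have h : ∃ T : (freeOp m).domain →ₗ[ℂ] LineL2 1,
      ∀ u : (freeOp m).domain, IsTrace (u : PhaseL2) (T u) :=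
    ⟨(dualAdjoint (opG hm hI)).toLinearMap ∘ₗ
      ((freeOp m).toFun - conj I • (freeOp m).domain.subtype),
      fun u => isTrace_dualAdjoint hm hI u⟩
  rw [traceMap, dif_pos h]
  exact h.choose_spec u

theorem traceMap_eq {m : ℝ} (hm : 0 < m) {z : ℂ} (hz : z.im ≠ 0) (u : (freeOp m).domain) :
    traceMap m u = dualAdjoint (opG hm hz) (freeOp m u - conj z • (u : PhaseL2)) :=
  (isTrace_traceMap hm u).unique (isTrace_dualAdjoint hm hz u)

theorem traceMap_bound {m : ℝ} (hm : 0 < m) : ∃ C : ℝ, ∀ u : (freeOp m).domain,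
    ‖traceMap m u‖ ≤ C * (‖(u : PhaseL2)‖ + ‖freeOp m u‖) := by
  have hI : I.im ≠ 0 := by simp
  refine ⟨‖dualAdjoint (opG hm hI)‖, fun u => ?_⟩
  rw [traceMap_eq hm hI u]
  refine (ContinuousLinearMap.le_opNorm _ _).trans ?_
  gcongr
  refine (norm_sub_le _ _).trans ?_
  rw [norm_smul]
  simp [add_comm]

theorem inner_opG {m : ℝ} (hm : 0 < m) {z : ℂ} (hz : z.im ≠ 0) (φ : LineL2 (-1))
    (u : (freeOp m).domain) :
    inner ℂ (opG hm hz φ) (freeOp m u - conj z • (u : PhaseL2)) =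
      ∫ p : ℝ, conj (φ p) * traceMap m u p := by
  rw [traceMap_eq hm hz u, integral_conj_mul_dualAdjoint]

end Trace

section KernelOfTrace

theorem mem_freeOpKer_domain_iff {m : ℝ} {f : PhaseL2} :
    f ∈ (freeOpKer m).domain ↔ ∃ hf : f ∈ (freeOp m).domain, traceMap m ⟨f, hf⟩ = 0 := by
  change f ∈ (LinearMap.ker (traceMap m)).map (freeOp m).domain.subtype ⊓ (freeOp m).domain ↔ _
  simp only [Submodule.mem_inf, Submodule.mem_map, LinearMap.mem_ker, Submodule.subtype_apply]
  constructor
  · rintro ⟨⟨u, hu, rfl⟩, h⟩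
    exact ⟨h, hu⟩
  · rintro ⟨hf, h⟩
    exact ⟨⟨⟨f, hf⟩, h, rfl⟩, hf⟩

theorem freeOpKer_le_freeOp (m : ℝ) : freeOpKer m ≤ freeOp m := LinearPMap.domRestrict_le

theorem freeOpKer_apply {m : ℝ} (u : (freeOpKer m).domain) :
    freeOpKer m u = freeOp m ⟨u, (freeOpKer_le_freeOp m).1 u.2⟩ :=
  (freeOpKer_le_freeOp m).2 rfl

theorem freeOp_isFormalAdjoint (m : ℝ) : (freeOp m).IsFormalAdjoint (freeOp m) := by
  have h := isSelfAdjoint_freeOp m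
  have h1 := LinearPMap.adjoint_isFormalAdjoint h.dense_domain
  rwa [LinearPMap.isSelfAdjoint_def.1 h] at h1

theorem freeOpKer_isFormalAdjoint (m : ℝ) : (freeOpKer m).IsFormalAdjoint (freeOpKer m) := by
  intro x y
  rw [freeOpKer_apply, freeOpKer_apply]
  exact freeOp_isFormalAdjoint m ⟨x, (freeOpKer_le_freeOp m).1 x.2⟩
    ⟨y, (freeOpKer_le_freeOp m).1 y.2⟩

theorem testLp_mem_freeOpKer {m : ℝ} (hm : 0 < m) {φ : ℝ × ℝ → ℂ} (hφ : ContDiff ℝ ∞ φ)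
    (hc : HasCompactSupport φ) (h0 : ∀ p, φ (0, p) = 0) :
    testLp hφ.continuous hc ∈ (freeOpKer m).domain := by
  obtain ⟨hf, -⟩ := (hasWeakTransport_testLp m hφ hc).mem_domain
  refine mem_freeOpKer_domain_iff.2 ⟨hf, (isTrace_traceMap hm ⟨_, hf⟩).unique ?_⟩
  refine ⟨φ, testLp_coeFn hφ.continuous hc, Filter.Eventually.of_forall fun p =>
    hφ.continuous.comp (by fun_prop), ?_⟩
  filter_upwards [Lp.coeFn_zero ℂ 2 (absMeasure 1)] with p hp
  rw [hp, h0, Pi.zero_apply]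

theorem dense_freeOpKer_domain {m : ℝ} (hm : 0 < m) :
    Dense ((freeOpKer m).domain : Set PhaseL2) := by
  rw [Submodule.dense_iff_topologicalClosure_eq_top,
    Submodule.topologicalClosure_eq_top_iff, Submodule.eq_bot_iff]
  intro f hf
  have hopen : IsOpen {x : ℝ × ℝ | x.1 ≠ 0} := isOpen_ne_fun continuous_fst continuous_const
  have hloc : LocallyIntegrable (f : ℝ × ℝ → ℂ) volume :=
    (Lp.memLp f).locallyIntegrable (by norm_num)
  have hzero : ∀ᵐ x : ℝ × ℝ, x.1 ≠ 0 → f x = 0 := by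
    refine hopen.ae_eq_zero_of_integral_contDiff_smul_eq_zero (hloc.locallyIntegrableOn _)
      fun g hg hgc hgs => ?_
    have hg' : ContDiff ℝ ∞ fun x => (g x : ℂ) := Complex.ofRealCLM.contDiff.comp hg
    have hgc' : HasCompactSupport fun x => (g x : ℂ) := hgc.comp_left Complex.ofReal_zero
    have hmem := testLp_mem_freeOpKer hm hg' hgc' fun p => by
      have : ((0 : ℝ), p) ∉ tsupport g := fun h => hgs h rfl
      rw [image_eq_zero_of_notMem_tsupport this, Complex.ofReal_zero]
    have hinner := (Submodule.mem_orthogonal _ _).1 hf _ hmem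
    rw [L2.inner_def] at hinner
    rw [← hinner]
    refine integral_congr_ae ?_
    filter_upwards [testLp_coeFn hg'.continuous hgc'] with x hx
    rw [hx]
    simp [mul_comm]
  refine Lp.eq_zero_iff_ae_eq_zero.2 ?_
  filter_upwards [hzero, Measure.quasiMeasurePreserving_fst.ae ae_ne_zero_real] with x h hx
  exact h hx

theorem mem_freeOpKer_graph_iff {m : ℝ} (hm : 0 < m) {z : ℂ} (hz : z.im ≠ 0)
    {x : PhaseL2 × PhaseL2} :
    x ∈ (freeOpKer m).graph ↔
      x ∈ (freeOp m).graph ∧ dualAdjoint (opG hm hz) (x.2 - conj z • x.1) = 0 := by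
  obtain ⟨f, g⟩ := x
  constructor
  · intro h
    obtain ⟨u, rfl, rfl⟩ := (LinearPMap.mem_graph_iff _).1 h
    obtain ⟨hu, h0⟩ := mem_freeOpKer_domain_iff.1 u.2
    rw [traceMap_eq hm hz] at h0
    rw [freeOpKer_apply]
    exact ⟨LinearPMap.mem_graph _ ⟨(u : PhaseL2), hu⟩, h0⟩
  · rintro ⟨h, h0⟩
    obtain ⟨u, rfl, rfl⟩ := (LinearPMap.mem_graph_iff _).1 h
    have hu : (u : PhaseL2) ∈ (freeOpKer m).domain :=
      mem_freeOpKer_domain_iff.2 ⟨u.2, (traceMap_eq hm hz u).trans h0⟩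
    have h1 := LinearPMap.mem_graph _ (⟨u, hu⟩ : (freeOpKer m).domain)
    rwa [freeOpKer_apply] at h1

theorem freeOpKer_isClosed {m : ℝ} (hm : 0 < m) : (freeOpKer m).IsClosed := by
  have hI : I.im ≠ 0 := by simp
  have hgraph : ((freeOpKer m).graph : Set (PhaseL2 × PhaseL2)) =
      ((freeOp m).graph : Set (PhaseL2 × PhaseL2)) ∩
        {x | dualAdjoint (opG hm hI) (x.2 - conj I • x.1) = 0} :=
    Set.ext fun _ => mem_freeOpKer_graph_iff hm hI
  rw [LinearPMap.IsClosed, hgraph]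
  exact (isSelfAdjoint_freeOp m).isClosed.inter (isClosed_eq (by fun_prop) continuous_const)

end KernelOfTrace

section GreenOperators

theorem opG_congr {m : ℝ} (hm : 0 < m) {z w : ℂ} (h : z = w) (hz : z.im ≠ 0) (hw : w.im ≠ 0) :
    opG hm hz = opG hm hw := by
  subst h; rfl

theorem sub_mul_integral_conj_green_mul_green {m : ℝ} (hm : 0 < m) {z w : ℂ} (hz : z.im ≠ 0)
    (hw : w.im ≠ 0) {p : ℝ} (hp : p ≠ 0) :
    (z - w) * (|p| * ∫ q, conj (green m (conj w) (q, p)) * green m z (q, p)) =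
      (imSign z - imSign w) * (I * m / 2) := by
  rw [integral_conj_green_mul_green hm z w hp]
  linear_combination (m : ℂ) * mul_integral_resolventKernel_neg_mul hz hw

theorem sub_smul_adjoint_opG_opG {m : ℝ} (hm : 0 < m) {z w : ℂ} (hz : z.im ≠ 0) (hw : w.im ≠ 0)
    (φ : LineL2 (-1)) :
    (z - w) • ContinuousLinearMap.adjoint (opG hm (conj_im_ne_zero hw)) (opG hm hz φ) =
      ((imSign z - imSign w) * (I * m / 2) : ℂ) • φ := by
  have hsw := (Measure.measurePreserving_swap (μ := (volume : Measure ℝ))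
      (ν := (volume : Measure ℝ))).quasiMeasurePreserving.ae (opG_coeFn hm hz φ)
  have hsl : ∀ᵐ p : ℝ, ∀ᵐ q : ℝ, opG hm hz φ (q, p) = green m z (q, p) * φ p :=
    Measure.ae_ae_of_ae_prod hsw
  refine Lp.ext ?_
  filter_upwards [Lp.coeFn_smul (z - w)
      (ContinuousLinearMap.adjoint (opG hm (conj_im_ne_zero hw)) (opG hm hz φ)),
    Lp.coeFn_smul ((imSign z - imSign w) * (I * m / 2) : ℂ) φ,
    adjoint_opG_coeFn hm (conj_im_ne_zero hw) (opG hm hz φ),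
    (ae_absMeasure_iff (-1)).2 hsl, (ae_absMeasure_iff (-1)).2 ae_ne_zero_real]
    with p h1 h2 h3 h4 hp
  rw [h1, h2, Pi.smul_apply, Pi.smul_apply, h3, smul_eq_mul, smul_eq_mul,
    ← sub_mul_integral_conj_green_mul_green hm hz hw hp]
  have e : ∫ q, conj (green m (conj w) (q, p)) * opG hm hz φ (q, p) =
      (∫ q, conj (green m (conj w) (q, p)) * green m z (q, p)) * φ p := by
    rw [← integral_mul_const]
    refine integral_congr_ae ?_
    filter_upwards [h4] with q hq
    rw [hq, mul_assoc]
  rw [e]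
  ring

theorem opG_sub_opG {m : ℝ} (hm : 0 < m) {z w : ℂ} (hz : z.im ≠ 0) (hw : w.im ≠ 0)
    (φ : LineL2 (-1)) :
    opG hm hz φ - opG hm hw φ = (z - w) • freeResolvent m w (opG hm hz φ) := by
  refine ext_inner_right ℂ fun v => ?_
  have hR := isResolventAt_freeResolvent m (conj_im_ne_zero hw)
  have h := (inner_opG hm hz φ ⟨_, hR.mem_domain v⟩).trans
    (inner_opG hm hw φ ⟨_, hR.mem_domain v⟩).symm
  have hadj : inner ℂ (freeResolvent m w (opG hm hz φ)) v =
      inner ℂ (opG hm hz φ) (freeResolvent m (conj w) v) := by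
    rw [← adjoint_freeResolvent m hw, ContinuousLinearMap.adjoint_inner_right]
  rw [hR.map_apply, add_sub_cancel_right, inner_sub_right, inner_add_right, inner_smul_right,
    inner_smul_right] at h
  rw [inner_sub_left, inner_smul_left, hadj, map_sub]
  linear_combination h

theorem adjoint_opG_sub {m : ℝ} (hm : 0 < m) {z w : ℂ} (hz : z.im ≠ 0) (hw : w.im ≠ 0)
    (f : PhaseL2) :
    (opG hm (conj_im_ne_zero hz)).adjoint f - (opG hm (conj_im_ne_zero hw)).adjoint f =
      (z - w) • (opG hm (conj_im_ne_zero hw)).adjoint (freeResolvent m z f) := by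
  refine ext_inner_left ℂ fun φ => ?_
  have h := congrArg (inner ℂ · f)
    (opG_sub_opG hm (conj_im_ne_zero hw) (conj_im_ne_zero hz) φ)
  simp only [inner_sub_left, inner_smul_left, ← adjoint_freeResolvent m hz,
    ContinuousLinearMap.adjoint_inner_left, conj_conj, map_sub] at h
  simp only [inner_smul_right, inner_sub_right, ContinuousLinearMap.adjoint_inner_right]
  linear_combination -h

theorem opG_injective {m : ℝ} (hm : 0 < m) {z : ℂ} (hz : z.im ≠ 0) :
    Function.Injective (opG hm hz) := by
  refine (injective_iff_map_eq_zero _).2 fun φ h => ?_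
  have hmc : (m : ℂ) ≠ 0 := by exact_mod_cast hm.ne'
  have h1 := sub_smul_adjoint_opG_opG hm hz (conj_im_ne_zero hz) φ
  rw [h, map_zero, smul_zero, eq_comm, smul_eq_zero, imSign_conj, sub_neg_eq_add, ← two_mul] at h1
  exact h1.resolve_left (by simp [imSign_ne_zero hz, hmc])

theorem inner_opG_freeOpKer {m : ℝ} (hm : 0 < m) {z : ℂ} (hz : z.im ≠ 0) (φ : LineL2 (-1))
    (u : (freeOpKer m).domain) :
    inner ℂ (opG hm hz φ) (freeOpKer m u - conj z • (u : PhaseL2)) = 0 := by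
  obtain ⟨hu, h0⟩ := mem_freeOpKer_domain_iff.1 u.2
  rw [traceMap_eq hm hz] at h0
  rw [freeOpKer_apply, ← integral_conj_mul_dualAdjoint, h0]
  refine integral_eq_zero_of_ae ?_
  filter_upwards [(ae_absMeasure_iff 1).1 (Lp.coeFn_zero ℂ 2 (absMeasure 1))] with p hp
  rw [hp, Pi.zero_apply, mul_zero]

theorem eq_zero_of_opG_mem_domain {m : ℝ} (hm : 0 < m) {z : ℂ} (hz : z.im ≠ 0)
    {φ : LineL2 (-1)} (h : opG hm hz φ ∈ (freeOp m).domain) : φ = 0 := by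
  have heigen : freeOp m ⟨_, h⟩ - z • opG hm hz φ = 0 := by
    refine (dense_freeOpKer_domain hm).eq_zero_of_inner_left ℂ fun u hu => ?_
    have h1 := inner_opG_freeOpKer hm hz φ ⟨u, hu⟩
    rw [freeOpKer_apply, inner_sub_right, inner_smul_right] at h1
    rw [inner_sub_left, inner_smul_left, freeOp_isFormalAdjoint m ⟨_, h⟩ ⟨u, _⟩]
    exact h1
  have hzero : opG hm hz φ = 0 := by
    simpa [heigen] using ((isResolventAt_freeResolvent m hz).2 ⟨_, h⟩).symm
  exact (injective_iff_map_eq_zero _).1 (opG_injective hm hz) φ hzero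

end GreenOperators

section OddProjection

/-- The reflection `f ↦ f(-·)`, as an isometry; the projector on odd functions is
`½ (1 - reflect)`. -/
def reflect (n : ℤ) : LineL2 n →ₗᵢ[ℂ] LineL2 n :=
  Lp.compMeasurePreservingₗᵢ ℂ (fun p : ℝ => -p) (measurePreserving_neg_absMeasure n)

theorem reflect_coeFn (n : ℤ) (f : LineL2 n) : reflect n f =ᵐ[absMeasure n] fun p => f (-p) :=
  Lp.coeFn_compMeasurePreserving f (measurePreserving_neg_absMeasure n)

theorem reflect_reflect (n : ℤ) (f : LineL2 n) : reflect n (reflect n f) = f := by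
  refine Lp.ext ?_
  filter_upwards [reflect_coeFn n (reflect n f),
    (measurePreserving_neg_absMeasure n).quasiMeasurePreserving.ae (reflect_coeFn n f)]
    with p h1 h2
  rw [h1, h2, neg_neg]

theorem oddProj_apply (n : ℤ) (f : LineL2 n) :
    oddProj n f = (1 / 2 : ℂ) • (f - reflect n f) := rfl

theorem oddProj_oddProj (n : ℤ) (f : LineL2 n) : oddProj n (oddProj n f) = oddProj n f := by
  simp only [oddProj_apply, map_smul, map_sub, reflect_reflect]
  module

theorem inner_oddProj (n : ℤ) (f g : LineL2 n) :
    inner ℂ (oddProj n f) g = inner ℂ f (oddProj n g) := by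
  have h : inner ℂ (reflect n f) g = inner ℂ f (reflect n g) := by
    conv_lhs => rw [← reflect_reflect n g]
    exact (reflect n).inner_map_map f _
  rw [oddProj_apply, oddProj_apply, inner_smul_left, inner_smul_right, inner_sub_left,
    inner_sub_right, h, map_div₀, map_one, map_ofNat]

theorem oddProj_weightedComp {n n' : ℤ} {k : ℝ → ℂ} {C : ℝ≥0}
    (h : WeightBound (absMeasure n) (absMeasure n') id k C) (hk : Measurable k)
    (heven : ∀ p, k (-p) = k p) (f : LineL2 n) :
    oddProj n' (weightedComp h measurable_id hk f) =
      weightedComp h measurable_id hk (oddProj n f) := by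
  have hr : reflect n' (weightedComp h measurable_id hk f) =
      weightedComp h measurable_id hk (reflect n f) := by
    refine Lp.ext ?_
    filter_upwards [reflect_coeFn n' (weightedComp h measurable_id hk f),
      (measurePreserving_neg_absMeasure n').quasiMeasurePreserving.ae
        (weightedComp_coeFn h measurable_id hk f),
      weightedComp_coeFn h measurable_id hk (reflect n f),
      (ae_absMeasure_iff n').2 ((ae_absMeasure_iff n).1 (reflect_coeFn n f))] with p h1 h2 h3 h4
    rw [h1, h2, h3, id, id, h4, heven]
  rw [oddProj_apply, oddProj_apply, hr, map_smul, map_sub]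

end OddProjection

section BoundaryOperator

theorem coupling_neg (b : OnePoint ℝ) (p : ℝ) : coupling b (-p) = coupling b p := by
  simp [coupling]

theorem symbolΛ_neg (m : ℝ) (b : OnePoint ℝ) (z : ℂ) (p : ℝ) :
    symbolΛ m b z (-p) = symbolΛ m b z p := by
  simp only [symbolΛ, coupling_neg, abs_neg]

theorem symbolΛ_eq (m : ℝ) (b : OnePoint ℝ) (z : ℂ) (p : ℝ) :
    symbolΛ m b z p = ((recip (coupling b p) : ℂ) - imSign z * (I * m / (2 * (|p| : ℝ))))⁻¹ := by
  rw [symbolΛ, one_div, imSign]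

theorem symbolΛ_denom_ne_zero {m : ℝ} (hm : 0 < m) {z : ℂ} (hz : z.im ≠ 0) (r : ℝ) {p : ℝ}
    (hp : p ≠ 0) : (r : ℂ) - imSign z * (I * m / (2 * (|p| : ℝ))) ≠ 0 := by
  intro h
  have hpos : 0 < m / (2 * |p|) := by positivity
  have hcast : (I * m / (2 * (|p| : ℝ)) : ℂ) = (m / (2 * |p|) : ℝ) * I := by push_cast; ring
  have him := congrArg Complex.im h
  rw [hcast] at him
  rcases lt_or_gt_of_ne hz with hz | hz
  · rw [imSign_of_neg hz] at him
    simp only [sub_im, ofReal_im, neg_mul, one_mul, neg_im, im_ofReal_mul, I_im,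
      zero_im] at him
    linarith
  · rw [imSign_of_pos hz] at him
    simp only [sub_im, ofReal_im, one_mul, im_ofReal_mul, I_im, zero_im] at him
    linarith

theorem conj_symbolΛ (m : ℝ) (b : OnePoint ℝ) (z : ℂ) (p : ℝ) :
    conj (symbolΛ m b z p) = symbolΛ m b (conj z) p := by
  simp only [symbolΛ_eq, map_inv₀, map_sub, map_mul, map_div₀, conj_ofReal, conj_I, imSign_conj,
    conj_imSign, map_ofNat]
  congr 1
  ring

theorem symbolΛ_sub_symbolΛ {m : ℝ} (hm : 0 < m) (b : OnePoint ℝ) {z w : ℂ} (hz : z.im ≠ 0)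
    (hw : w.im ≠ 0) {p : ℝ} (hp : p ≠ 0) :
    symbolΛ m b z p * ((|p|)⁻¹ : ℝ) - symbolΛ m b w p * ((|p|)⁻¹ : ℝ) =
      ((imSign z - imSign w) * (I * m / 2) : ℂ) *
        (symbolΛ m b w p * ((|p|)⁻¹ : ℝ) * (symbolΛ m b z p * ((|p|)⁻¹ : ℝ))) := by
  have hz' := symbolΛ_denom_ne_zero hm hz (recip (coupling b p)) hp
  have hw' := symbolΛ_denom_ne_zero hm hw (recip (coupling b p)) hp
  have hpc : ((|p| : ℝ) : ℂ) ≠ 0 := by simpa using hp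
  rw [symbolΛ_eq, symbolΛ_eq, ← sub_mul, inv_sub_inv hz' hw', ofReal_inv]
  generalize hDz : (recip (coupling b p) : ℂ) - imSign z * (I * m / (2 * (|p| : ℝ))) = Dz at hz' ⊢
  generalize hDw : (recip (coupling b p) : ℂ) - imSign w * (I * m / (2 * (|p| : ℝ))) = Dw at hw' ⊢
  have hdiff : Dw - Dz = (imSign z - imSign w) * (I * m / 2) / (|p| : ℝ) := by
    rw [← hDz, ← hDw]
    ring
  rw [hdiff]
  field_simp

theorem oddProj_opΛ {m : ℝ} (hm : 0 < m) (b : OnePoint ℝ) {z : ℂ} (hz : z.im ≠ 0) (φ : LineL2 1) :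
    oddProj (-1) (opΛ hm b hz φ) = opΛ hm b hz (oddProj 1 φ) :=
  oddProj_weightedComp _ _ (symbolΛ_neg m b z) φ

/-- The operator `Λ^B_z |p|⁻¹` in `L²(ℝ, |p|⁻¹dp)`; the factor `|p|⁻¹` turns the duality with
`L²(ℝ, |p|dp)` into the scalar product of `L²(ℝ, |p|⁻¹dp)`. -/
def symbolOp {m : ℝ} (hm : 0 < m) (b : OnePoint ℝ) {z : ℂ} (hz : z.im ≠ 0) :
    LineL2 (-1) →L[ℂ] LineL2 (-1) :=
  opΛ hm b hz ∘L weightedComp weightBound_invAbs measurable_id measurable_invAbs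

theorem symbolOp_coeFn {m : ℝ} (hm : 0 < m) (b : OnePoint ℝ) {z : ℂ} (hz : z.im ≠ 0)
    (φ : LineL2 (-1)) : symbolOp hm b hz φ =ᵐ[absMeasure (-1)]
      fun p => symbolΛ m b z p * ((|p|)⁻¹ : ℝ) * φ p := by
  filter_upwards [weightedComp_coeFn (weightBound_symbolΛ hm b hz) measurable_id
      (measurable_symbolΛ m b z)
      (weightedComp weightBound_invAbs measurable_id measurable_invAbs φ),
    (ae_absMeasure_iff (-1)).2 ((ae_absMeasure_iff 1).1
      (weightedComp_coeFn weightBound_invAbs measurable_id measurable_invAbs φ))] with p h1 h2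
  rw [symbolOp, ContinuousLinearMap.comp_apply, opΛ, h1, id, h2, id, mul_assoc]

theorem oddProj_symbolOp {m : ℝ} (hm : 0 < m) (b : OnePoint ℝ) {z : ℂ} (hz : z.im ≠ 0)
    (φ : LineL2 (-1)) : oddProj (-1) (symbolOp hm b hz φ) = symbolOp hm b hz (oddProj (-1) φ) := by
  simp only [symbolOp, ContinuousLinearMap.comp_apply]
  rw [oddProj_opΛ, oddProj_weightedComp _ _ fun p => by rw [abs_neg]]

theorem inner_symbolOp {m : ℝ} (hm : 0 < m) (b : OnePoint ℝ) {z : ℂ} (hz : z.im ≠ 0)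
    (φ ψ : LineL2 (-1)) : inner ℂ (symbolOp hm b hz φ) ψ =
      inner ℂ φ (symbolOp hm b (conj_im_ne_zero hz) ψ) := by
  rw [L2.inner_def, L2.inner_def]
  refine integral_congr_ae ?_
  filter_upwards [symbolOp_coeFn hm b hz φ, symbolOp_coeFn hm b (conj_im_ne_zero hz) ψ]
    with p h1 h2
  rw [h1, h2]
  simp only [RCLike.inner_apply, map_mul, conj_symbolΛ, conj_ofReal]
  ring

theorem symbolOp_sub_symbolOp {m : ℝ} (hm : 0 < m) (b : OnePoint ℝ) {z w : ℂ} (hz : z.im ≠ 0)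
    (hw : w.im ≠ 0) (φ : LineL2 (-1)) :
    symbolOp hm b hz φ - symbolOp hm b hw φ =
      ((imSign z - imSign w) * (I * m / 2) : ℂ) • symbolOp hm b hw (symbolOp hm b hz φ) := by
  refine Lp.ext ?_
  filter_upwards [Lp.coeFn_smul ((imSign z - imSign w) * (I * m / 2) : ℂ)
      (symbolOp hm b hw (symbolOp hm b hz φ)),
    Lp.coeFn_sub (symbolOp hm b hz φ) (symbolOp hm b hw φ),
    symbolOp_coeFn hm b hw (symbolOp hm b hz φ), symbolOp_coeFn hm b hz φ,
    symbolOp_coeFn hm b hw φ, (ae_absMeasure_iff (-1)).2 ae_ne_zero_real]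
    with p h_smul h_sub h_comp hz_apply hw_apply hp
  rw [h_smul, h_sub, Pi.smul_apply, Pi.sub_apply, h_comp, hz_apply, hw_apply, smul_eq_mul]
  linear_combination φ p * symbolΛ_sub_symbolΛ hm b hz hw hp

/-- The operator `Π' Λ^B_z Π' |p|⁻¹` in `L²(ℝ, |p|⁻¹dp)`, so that
`R^B_z = R⁰_z + G_z (Π' Λ^B_z Π' |p|⁻¹) G_{z̄}†` with `†` the Hilbert adjoint. -/
def boundaryOp {m : ℝ} (hm : 0 < m) (b : OnePoint ℝ) {z : ℂ} (hz : z.im ≠ 0) :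
    LineL2 (-1) →L[ℂ] LineL2 (-1) :=
  oddProj (-1) ∘L opΛ hm b hz ∘L oddProj 1 ∘L
    weightedComp weightBound_invAbs measurable_id measurable_invAbs

theorem boundaryOp_apply {m : ℝ} (hm : 0 < m) (b : OnePoint ℝ) {z : ℂ} (hz : z.im ≠ 0)
    (φ : LineL2 (-1)) : boundaryOp hm b hz φ = oddProj (-1) (symbolOp hm b hz φ) := by
  simp only [boundaryOp, symbolOp, ContinuousLinearMap.comp_apply]
  rw [oddProj_opΛ, oddProj_opΛ, oddProj_oddProj]

theorem adjoint_boundaryOp {m : ℝ} (hm : 0 < m) (b : OnePoint ℝ) {z : ℂ} (hz : z.im ≠ 0) :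
    (boundaryOp hm b hz).adjoint = boundaryOp hm b (conj_im_ne_zero hz) := by
  refine ContinuousLinearMap.ext fun ψ => ext_inner_left ℂ fun φ => ?_
  rw [ContinuousLinearMap.adjoint_inner_right, boundaryOp_apply, boundaryOp_apply, inner_oddProj,
    inner_symbolOp, oddProj_symbolOp]

theorem boundaryOp_sub_boundaryOp {m : ℝ} (hm : 0 < m) (b : OnePoint ℝ) {z w : ℂ} (hz : z.im ≠ 0)
    (hw : w.im ≠ 0) (φ : LineL2 (-1)) :
    boundaryOp hm b hz φ - boundaryOp hm b hw φ =
      ((imSign z - imSign w) * (I * m / 2) : ℂ) • boundaryOp hm b hw (boundaryOp hm b hz φ) := by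
  simp only [boundaryOp_apply, ← oddProj_symbolOp, oddProj_oddProj]
  rw [← map_sub, symbolOp_sub_symbolOp, map_smul]

end BoundaryOperator

section Krein

variable {m : ℝ} (hm : 0 < m) (b : OnePoint ℝ) {z w : ℂ} (hz : z.im ≠ 0)

theorem kreinResolvent_eq : kreinResolvent hm b hz =
    freeResolvent m z + opG hm hz ∘L boundaryOp hm b hz ∘L
      (opG hm (conj_im_ne_zero hz)).adjoint := rfl

theorem kreinResolvent_sub_kreinResolvent (hw : w.im ≠ 0) (f : PhaseL2) :
    kreinResolvent hm b hz f - kreinResolvent hm b hw f =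
      (z - w) • kreinResolvent hm b hw (kreinResolvent hm b hz f) := by
  have hΘ (φ : LineL2 (-1)) : boundaryOp hm b hz φ - boundaryOp hm b hw φ =
      (z - w) • boundaryOp hm b hw
        ((opG hm (conj_im_ne_zero hw)).adjoint (opG hm hz (boundaryOp hm b hz φ))) := by
    rw [boundaryOp_sub_boundaryOp hm b hz hw, ← map_smul (boundaryOp hm b hw) (z - w),
      sub_smul_adjoint_opG_opG hm hz hw, map_smul]
  exact krein_resolvent_identity
    ((isResolventAt_freeResolvent m hz).apply_sub_apply (isResolventAt_freeResolvent m hw))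
    (opG_sub_opG hm hz hw) (adjoint_opG_sub hm hz hw) hΘ f

theorem kreinResolvent_injective : Function.Injective (kreinResolvent hm b hz) :=
  (isResolventAt_freeResolvent m hz).add_injective fun f hf => by
    rw [ContinuousLinearMap.comp_apply] at hf ⊢
    rw [eq_zero_of_opG_mem_domain hm hz hf, map_zero]

theorem adjoint_kreinResolvent :
    (kreinResolvent hm b hz).adjoint = kreinResolvent hm b (conj_im_ne_zero hz) := by
  simp only [kreinResolvent_eq, map_add, ContinuousLinearMap.adjoint_comp,
    ContinuousLinearMap.adjoint_adjoint, adjoint_freeResolvent m hz, adjoint_boundaryOp,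
    opG_congr hm (Complex.conj_conj z) _ hz, ContinuousLinearMap.comp_assoc]

theorem kreinResolvent_freeOp (u : (freeOp m).domain) :
    kreinResolvent hm b hz (freeOp m u - z • (u : PhaseL2)) =
      u + opG hm hz (opΛ hm b hz (oddProj 1 (traceMap m u))) := by
  have hγ := traceMap_eq hm (conj_im_ne_zero hz) u
  rw [Complex.conj_conj] at hγ
  simp only [kreinResolvent, add_apply, ContinuousLinearMap.comp_apply, ← hγ, oddProj_opΛ,
    oddProj_oddProj, (isResolventAt_freeResolvent m hz).2 u]

theorem exists_isResolventAt_kreinResolvent : ∃ LB : PhaseL2 →ₗ.[ℂ] PhaseL2,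
    ∀ (z : ℂ) (hz : z.im ≠ 0), IsResolventAt LB z (kreinResolvent hm b hz) := by
  obtain ⟨LB, hLB⟩ := exists_isResolventAt_of_resolvent_identity
    (z := fun i : {z : ℂ // z.im ≠ 0} => (i : ℂ)) (R := fun i => kreinResolvent hm b i.2)
    (i₀ := ⟨I, by simp⟩) (kreinResolvent_injective hm b _)
    fun i j f => kreinResolvent_sub_kreinResolvent hm b i.2 j.2 f
  exact ⟨LB, fun z hz => hLB ⟨z, hz⟩⟩

variable {hm b hz} {LB : PhaseL2 →ₗ.[ℂ] PhaseL2}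

theorem freeOpKer_le (h : IsResolventAt LB z (kreinResolvent hm b hz)) : freeOpKer m ≤ LB := by
  refine h.le_of_eq_zero (freeOpKer_le_freeOp m) (kreinResolvent_freeOp hm b hz) fun u => ?_
  obtain ⟨_, hγ⟩ := mem_freeOpKer_domain_iff.1 u.2
  rw [hγ, map_zero, map_zero, map_zero]

end Krein

end DeltaPrime

end

theorem theorem2p1 (m : ℝ) (hm : 0 < m) (b : OnePoint ℝ) (hb : b ≠ ((0 : ℝ) : OnePoint ℝ)) :
    -- the trace map, the free resolvent and `G_z` are what they are meant to be
    (∀ u : (freeOp m).domain, IsTrace (u : PhaseL2) (traceMap m u)) ∧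
    (∃ C : ℝ, ∀ u : (freeOp m).domain, ‖traceMap m u‖ ≤ C * (‖(u : PhaseL2)‖ + ‖freeOp m u‖)) ∧
    IsSelfAdjoint (freeOp m) ∧
    (∀ z : ℂ, z.im ≠ 0 → IsResolvent (freeOp m) z (freeResolvent m z)) ∧
    (∀ (z : ℂ) (hz : z.im ≠ 0) (φ : LineL2 (-1)) (u : (freeOp m).domain),
      inner ℂ (opG hm hz φ) (freeOp m u - conj z • (u : PhaseL2)) =
        ∫ p : ℝ, conj (φ p) * traceMap m u p) ∧
    -- `L₀` restricted to `ker γ` is densely defined, closed and symmetric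
    Dense ((freeOpKer m).domain : Set PhaseL2) ∧
    (freeOpKer m).IsClosed ∧
    (freeOpKer m).IsFormalAdjoint (freeOpKer m) ∧
    -- the self-adjoint extension `L_B`
    ∃ LB : PhaseL2 →ₗ.[ℂ] PhaseL2,
      IsSelfAdjoint LB ∧
      freeOpKer m ≤ LB ∧
      ∀ (z : ℂ) (hz : z.im ≠ 0),
        IsResolvent LB z (kreinResolvent hm b hz) ∧
        (∀ f : PhaseL2, f ∈ LB.domain ↔
          ∃ u : (freeOp m).domain,
            f = u + opG hm hz (opΛ hm b hz (oddProj 1 (traceMap m u)))) ∧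
        ∀ (f : LB.domain) (u : (freeOp m).domain),
          (f : PhaseL2) = u + opG hm hz (opΛ hm b hz (oddProj 1 (traceMap m u))) →
            LB f - z • (f : PhaseL2) = freeOp m u - z • (u : PhaseL2) := by
  obtain ⟨LB, hLB⟩ := exists_isResolventAt_kreinResolvent hm b
  have hI : Complex.I.im ≠ 0 := by simp
  have hLB_adjoint : IsSelfAdjoint LB :=
    (hLB _ hI).isSelfAdjoint (adjoint_kreinResolvent hm b hI ▸ hLB _ (conj_im_ne_zero hI))
  have hLB_Green (z : ℂ) (hz : z.im ≠ 0) := kreinResolvent_freeOp hm b hz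
  exact ⟨isTrace_traceMap hm, traceMap_bound hm, isSelfAdjoint_freeOp m,
    fun z hz => isResolventAt_freeResolvent m hz, fun z hz => inner_opG hm hz,
    dense_freeOpKer_domain hm, freeOpKer_isClosed hm, freeOpKer_isFormalAdjoint m,
    LB, hLB_adjoint, freeOpKer_le (hLB _ hI), fun z hz =>
      ⟨hLB z hz,
        (isResolventAt_freeResolvent m hz).mem_domain_iff_exists_add (hLB z hz) (hLB_Green z hz),
        fun _ _ => (hLB z hz).sub_smul_eq_of_eq_add (hLB_Green z hz)⟩⟩
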